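/- Let $\Gamma$ be a countable group, let $(B,d_B)$ be a compact metric space with its Borel $\sigma$-algebra, let $\nu$ be a Borel probability measure on $B$, and let $\Gamma\curvearrowright(B,\nu)$ be a nonsingular action by Borel maps. Write $(\nu\circ g)(E)=\nu(gE)$. Let $R:\Gamma\times B\to\mathbb R$ be Borel with $R(g_2g_1,b)=R(g_2,g_1b)+R(g_1,b)$ for all $g_1,g_2\in\Gamma$, $b\in B$, and with $R(g,b)=\log\frac{d\nu\circ g}{d\nu}(b)$ for every $g$ and $\nu$-almost every $b$. *Definitions.* The action is **ergodic** if every invariant measurable set is $\nu$-null or $\nu$-conull. It is **weakly mixing** if for every ergodic probability-measure-preserving (pmp) action of $\Gamma$ on a standard probability space $(X,\mu)$ the diagonal action $\Gamma\curvearrowright(B\times X,\nu\times\mu)$ is ergodic. The **ratio set** $RS(\Gamma\curvearrowright(B,\nu))\subset[0,\infty]$ is defined as follows. A real $r\ge 0$ belongs to it iff for every measurable $A\subset B$ with $\nu(A)>0$ and every $\epsilon>0$ there are a measurable $A'\subset A$ with $\nu(A')>0$ and $g\in\Gamma\setminus\{e\}$ with $gA'\subset A$ and $|\frac{d\nu\circ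 g}{d\nu}(b)-r|<\epsilon$ for all $b\in A'$. The point $\infty$ belongs to it iff for every such $A$ and every $n>0$ there are such $A'$ and $g$ with $gA'\subset A$ and $\frac{d\nu\circ g}{d\nu}(b)>n$ for all $b\in A'$. The **stable ratio set** is the intersection of $RS(\Gamma\curvearrowright(B\times X,\nu\times\mu))$ over all pmp actions of $\Gamma$ on standard probability spaces $(X,\mu)$. An ergodic action is of **type $III_0$** if its ratio set is $\{0,1,\infty\}$; a weakly mixing action is of **stable type $III_0$** if its stable ratio set is $\{0,1,\infty\}$. An **admissible family** is a sequence of nonnegative real-valued Borel functions $\Upsilon_n$ on $\Gamma\times B\times B$ such that, with $S_n=\{(g,b,b'):\Upsilon_n(g,b,b')>0\}$: 1. $\sum_{g\in\Gamma}\int\Upsilon_n(g,b,b')\,d\nu(b')=1$ for all $n$ and $b$. 2. There is $\beta:\mathbb N\to\mathbb R$ with $\beta(n)\to0$ such that $d_B(b,b')\le\beta(n)$ and $d_B(g^{-1}b,g^{-1}b')\le\beta(n)$ for all $n$ and all $(g,b,b')\in S_n$. 3. There is $C>0$ such that for all $n$, $|R(g^{-1},b)|+|R(g^{-1},b')|\le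 C$ for almost every $(g,b,b')\in S_n$ (with respect to the product of counting measure on $\Gamma$ and $\nu\times\nu$). 4. There is $C>0$ such that for all $n$, $$\int\sum_{g}\Upsilon_n(g,b,b')\,d\nu(b)\le C\ \text{ for a.e. } b',$$ $$\int\sum_{g}\Upsilon_n(g,b,gb')\tfrac{d\nu\circ g}{d\nu}(b')\,d\nu(b)\le C\ \text{ for a.e. } b',$$ $$\int\sum_{g}\Upsilon_n(g,gb,b')\tfrac{d\nu\circ g}{d\nu}(b)\,d\nu(b')\le C\ \text{ for a.e. } b.$$ *Statement.* Let $\{\Upsilon_n\}$ be an admissible family for $\Gamma\curvearrowright(B,\nu)$, let $\zeta_n$ be the probability measure on $\mathbb R$ given by $$\zeta_n(E)=\sum_{g\in\Gamma}\iint 1_E\big(R(g^{-1},b')-R(g^{-1},b)\big)\,\Upsilon_n(g,b,b')\,d\nu(b')\,d\nu(b),$$ and let $\zeta_\infty$ be any weak* limit point of $\{\zeta_n\}$ (a probability measure on $\mathbb R$). Suppose that some $T\neq0$ lies in the support of $\zeta_\infty$. If $\Gamma\curvearrowright(B,\nu)$ is ergodic, then it is not of type $III_0$. If $\Gamma\curvearrowright(B,\nu)$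 is weakly mixing, then it is not of stable type $III_0$. -/

import Mathlib

open MeasureTheory Filter Topology
open scoped ENNReal NNReal

noncomputable section

namespace NonsingularAction

/-- The action of `Γ` on `(B, ν)` is nonsingular: every group element acts by a measurable map
that sends `ν` to an absolutely continuous measure (hence, using inverses, to an equivalent
one). -/
def IsNonsingular (Γ : Type*) [Group Γ] {B : Type*} [MeasurableSpace B] [MulAction Γ B]
    (ν : Measure B) : Prop :=
  ∀ g : Γ, Measure.QuasiMeasurePreserving (fun b : B => g • b) ν ν

/-- The action of `Γ` on `(X, μ)` is measure preserving. -/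
def IsMeasurePreserving (Γ : Type*) [Group Γ] {X : Type*} [MeasurableSpace X] [MulAction Γ X]
    (μ : Measure X) : Prop :=
  ∀ g : Γ, MeasurePreserving (fun x : X => g • x) μ μ

/-- The action of `Γ` on `(B, ν)` is ergodic: every invariant measurable set is null or conull. -/
def IsErgodic (Γ : Type*) [Group Γ] {B : Type*} [MeasurableSpace B] [MulAction Γ B]
    (ν : Measure B) : Prop :=
  ∀ s : Set B, MeasurableSet s → (∀ g : Γ, (fun b : B => g • b) ⁻¹' s = s) →
    ν s = 0 ∨ ν sᶜ = 0

/-- The Radon–Nikodym derivative `d(ν ∘ g)/dν`, where `(ν ∘ g)(E) = ν (g E)`; thus `ν ∘ g` is the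
push-forward of `ν` under `g⁻¹`. -/
def rnDerivAction {Γ : Type*} [Group Γ] {B : Type*} [MeasurableSpace B] [MulAction Γ B]
    (ν : Measure B) (g : Γ) : B → ℝ≥0∞ :=
  (ν.map (fun b : B => g⁻¹ • b)).rnDeriv ν

/-- The ratio set of the action of `Γ` on `(B, ν)`, a subset of `[0, ∞]`. -/
def ratioSet (Γ : Type*) [Group Γ] {B : Type*} [MeasurableSpace B] [MulAction Γ B]
    (ν : Measure B) : Set ℝ≥0∞ :=
  {r | ∀ A : Set B, MeasurableSet A → 0 < ν A →
    (r ≠ ∞ → ∀ ε : ℝ, 0 < ε → ∃ A' ⊆ A, MeasurableSet A' ∧ 0 < ν A' ∧ ∃ g : Γ, g ≠ 1 ∧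
      (∀ b ∈ A', g • b ∈ A) ∧ ∀ b ∈ A', |(rnDerivAction ν g b).toReal - r.toReal| < ε) ∧
    (r = ∞ → ∀ n : ℕ, ∃ A' ⊆ A, MeasurableSet A' ∧ 0 < ν A' ∧ ∃ g : Γ, g ≠ 1 ∧
      (∀ b ∈ A', g • b ∈ A) ∧ ∀ b ∈ A', (n : ℝ≥0∞) < rnDerivAction ν g b)}

/-- The stable ratio set: the intersection of the ratio sets of the diagonal actions on
`(B × X, ν × μ)`, over all probability-measure-preserving actions of `Γ` on standard probability
spaces `(X, μ)`. (Every standard Borel space is isomorphic to one in `Type`.) -/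
def stableRatioSet (Γ : Type*) [Group Γ] {B : Type*} [MeasurableSpace B] [MulAction Γ B]
    (ν : Measure B) : Set ℝ≥0∞ :=
  {r | ∀ (X : Type) [MeasurableSpace X] [StandardBorelSpace X] [MulAction Γ X]
    (μ : Measure X) [IsProbabilityMeasure μ], IsMeasurePreserving Γ μ →
      r ∈ ratioSet Γ (ν.prod μ)}

/-- The action on `(B, ν)` is weakly mixing: its product with any ergodic
probability-measure-preserving action on a standard probability space is ergodic. -/
def IsWeaklyMixing (Γ : Type*) [Group Γ] {B : Type*} [MeasurableSpace B] [MulAction Γ B]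
    (ν : Measure B) : Prop :=
  ∀ (X : Type) [MeasurableSpace X] [StandardBorelSpace X] [MulAction Γ X]
    (μ : Measure X) [IsProbabilityMeasure μ], IsMeasurePreserving Γ μ → IsErgodic Γ μ →
      IsErgodic Γ (ν.prod μ)

/-- Type `III₀`: the action is ergodic (the type is undefined otherwise) with ratio set
`{0, 1, ∞}`. -/
def IsTypeIIIZero (Γ : Type*) [Group Γ] {B : Type*} [MeasurableSpace B] [MulAction Γ B]
    (ν : Measure B) : Prop :=
  IsErgodic Γ ν ∧ ratioSet Γ ν = {0, 1, ∞}

/-- Stable type `III₀`: the action is weakly mixing (the stable type is undefined otherwise) with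
stable ratio set `{0, 1, ∞}`. -/
def IsStableTypeIIIZero (Γ : Type*) [Group Γ] {B : Type*} [MeasurableSpace B] [MulAction Γ B]
    (ν : Measure B) : Prop :=
  IsWeaklyMixing Γ ν ∧ stableRatioSet Γ ν = {0, 1, ∞}

/-- `R` is a Borel additive cocycle, satisfying the cocycle identity everywhere and agreeing almost
everywhere with the logarithm of the Radon–Nikodym derivative. -/
structure IsLogRNCocycle {Γ : Type*} [Group Γ] {B : Type*} [MeasurableSpace B] [MulAction Γ B]
    (ν : Measure B) (R : Γ → B → ℝ) : Prop where
  measurable : ∀ g, Measurable (R g)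
  cocycle : ∀ g₂ g₁ b, R (g₂ * g₁) b = R g₂ (g₁ • b) + R g₁ b
  ae_eq : ∀ g, ∀ᵐ b ∂ν, R g b = Real.log (rnDerivAction ν g b).toReal

/-- Admissible families of kernels `Υ n : Γ × B × B → [0, ∞)`. As `Γ` is countable and discrete,
Borel measurability on `Γ × B × B`, and "almost everywhere" for the product of counting measure
with `ν × ν`, are expressed for each `g` separately. -/
structure IsAdmissibleFamily {Γ : Type*} [Group Γ] {B : Type*} [MetricSpace B]
    [MeasurableSpace B] [MulAction Γ B] (ν : Measure B) (R : Γ → B → ℝ)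
    (Υ : ℕ → Γ → B → B → ℝ≥0) : Prop where
  measurable : ∀ n g, Measurable (fun p : B × B => Υ n g p.1 p.2)
  sum_eq_one : ∀ n b, ∑' g, ∫⁻ b', (Υ n g b b' : ℝ≥0∞) ∂ν = 1
  dist_le : ∃ β : ℕ → ℝ, Tendsto β atTop (𝓝 0) ∧ ∀ n g b b', 0 < Υ n g b b' →
    dist b b' ≤ β n ∧ dist (g⁻¹ • b) (g⁻¹ • b') ≤ β n
  cocycle_bound : ∃ C : ℝ, 0 < C ∧ ∀ n g, ∀ᵐ p ∂(ν.prod ν), 0 < Υ n g p.1 p.2 →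
    |R g⁻¹ p.1| + |R g⁻¹ p.2| ≤ C
  integral_bound : ∃ C : ℝ≥0, 0 < C ∧ ∀ n,
    (∀ᵐ b' ∂ν, ∫⁻ b, ∑' g, (Υ n g b b' : ℝ≥0∞) ∂ν ≤ C) ∧
    (∀ᵐ b' ∂ν, ∫⁻ b, ∑' g, (Υ n g b (g • b') : ℝ≥0∞) * rnDerivAction ν g b' ∂ν ≤ C) ∧
    (∀ᵐ b ∂ν, ∫⁻ b', ∑' g, (Υ n g (g • b) b' : ℝ≥0∞) * rnDerivAction ν g b ∂ν ≤ C)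

/-- The measure `ζ_n` on `ℝ`; see `zeta_apply` for its values. -/
def zeta {Γ : Type*} [Group Γ] {B : Type*} [MeasurableSpace B]
    (ν : Measure B) (R : Γ → B → ℝ) (Υ : ℕ → Γ → B → B → ℝ≥0) (n : ℕ) : Measure ℝ :=
  Measure.sum fun g : Γ =>
    ((ν.prod ν).withDensity fun p => (Υ n g p.1 p.2 : ℝ≥0∞)).map
      fun p => R g⁻¹ p.2 - R g⁻¹ p.1

section

variable {Γ : Type*} [Group Γ] {B : Type*} [MetricSpace B] [MeasurableSpace B]
  [MulAction Γ B] {ν : Measure B} [IsProbabilityMeasure ν] {R : Γ → B → ℝ}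
  {Υ : ℕ → Γ → B → B → ℝ≥0}

/-- `ζ_n(E) = ∑_g ∬ 1_E(R(g⁻¹,b') - R(g⁻¹,b)) Υ_n(g,b,b') dν(b') dν(b)`. -/
theorem zeta_apply (hR : IsLogRNCocycle ν R) (hΥ : IsAdmissibleFamily ν R Υ) (n : ℕ)
    {E : Set ℝ} (hE : MeasurableSet E) :
    zeta ν R Υ n E = ∑' g : Γ, ∫⁻ b, ∫⁻ b',
      E.indicator 1 (R g⁻¹ b' - R g⁻¹ b) * (Υ n g b b' : ℝ≥0∞) ∂ν ∂ν := by
  rw [zeta, Measure.sum_apply _ hE]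
  congr 1
  ext g
  have hm : Measurable fun p : B × B => R g⁻¹ p.2 - R g⁻¹ p.1 :=
    ((hR.measurable _).comp measurable_snd).sub ((hR.measurable _).comp measurable_fst)
  have hu : Measurable fun p : B × B => (Υ n g p.1 p.2 : ℝ≥0∞) :=
    (hΥ.measurable n g).coe_nnreal_ennreal
  have hi : Measurable (E.indicator (1 : ℝ → ℝ≥0∞)) := measurable_one.indicator hE
  rw [Measure.map_apply hm hE, withDensity_apply _ (hm hE), ← lintegral_indicator (hm hE)]
  have h2 : ((fun p : B × B => R g⁻¹ p.2 - R g⁻¹ p.1) ⁻¹' E).indicator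
      (fun p => (Υ n g p.1 p.2 : ℝ≥0∞)) =
      fun p => E.indicator 1 (R g⁻¹ p.2 - R g⁻¹ p.1) * (Υ n g p.1 p.2 : ℝ≥0∞) := by
    ext p
    by_cases h : R g⁻¹ p.2 - R g⁻¹ p.1 ∈ E <;> simp [Set.indicator, h]
  rw [h2]
  exact lintegral_prod _ ((hi.comp hm).mul hu).aemeasurable

theorem isProbabilityMeasure_zeta [Countable Γ] (hR : IsLogRNCocycle ν R)
    (hΥ : IsAdmissibleFamily ν R Υ) (n : ℕ) : IsProbabilityMeasure (zeta ν R Υ n) := by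
  constructor
  rw [zeta_apply hR hΥ n MeasurableSet.univ]
  simp only [Set.indicator_univ, Pi.one_apply, one_mul]
  rw [← lintegral_tsum]
  · simp [hΥ.sum_eq_one n]
  · intro g
    exact ((hΥ.measurable n g).coe_nnreal_ennreal.lintegral_prod_right').aemeasurable

/-- `ζ_n` as a point of the space of Borel probability measures on `ℝ` with the weak topology. -/
def zetaProb [Countable Γ] (hR : IsLogRNCocycle ν R) (hΥ : IsAdmissibleFamily ν R Υ) (n : ℕ) :
    ProbabilityMeasure ℝ :=
  ⟨zeta ν R Υ n, isProbabilityMeasure_zeta hR hΥ n⟩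

end

end NonsingularAction

end

/-! The claim is that `exp T` lies in the (stable) ratio set; as `T ≠ 0`, it is none of `0`, `1`,
`∞`.

Let `A ⊆ B × X` have conull saturation, and suppose that its return cocycle avoids a neighbourhood
of `T`. The saturation `W` of `A × [0, η)` under `(b, x, t) ↦ (g b, g x, t + R g b)` (the Maharam
extension) is invariant. Its sections `W_b ⊆ X × ℝ` depend almost continuously on `b`. On the
support of `Υ n`, `b` is close to `b'` and `g⁻¹ b` to `g⁻¹ b'`, so on average `W_b ≈ W_b'` and
`W_{g⁻¹ b} ≈ W_{g⁻¹ b'}` (`tendsto_lintegral_symmDiff_section`). Comparing the two by invariance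
makes `W_b` almost invariant under translation by `R g⁻¹ b' - R g⁻¹ b`
(`measure_translate_maharamSaturation_le`). Translation by a number near `T`, however, moves `W_b`
by a definite amount (`le_volume_translate_maharamSaturation`). Hence `ζ_n` gives vanishing mass to
a ball about `T` (`tendsto_zeta_ball`), which contradicts `T` being in the support of the limit
point.

Ergodicity makes the saturation of a positive set conull; in the ergodic case `X` is a point. For
the stable statement, `μ` need not be ergodic, so it is disintegrated into ergodic measures, to
which weak mixing applies. -/

noncomputable section

namespace NonsingularAction

/-! ### Almost continuity of sections. -/

/-- Sections of a measurable set vary almost continuously in measure: outside of an error that is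
small on average, nearby points have sections with small symmetric difference. -/
theorem exists_symmDiff_section_le {B Y : Type*} [MetricSpace B] [CompactSpace B]
    [MeasurableSpace B] [BorelSpace B] [MeasurableSpace Y] [StandardBorelSpace Y]
    (ν : Measure B) [IsFiniteMeasure ν] (l : Measure Y) [IsFiniteMeasure l]
    {W : Set (B × Y)} (hW : MeasurableSet W) {ε : ℝ} (hε : 0 < ε) :
    ∃ h : B → ℝ≥0∞, Measurable h ∧ ∫⁻ b, h b ∂ν ≤ ENNReal.ofReal ε ∧ ∃ δ > 0, ∀ b b', dist b b' < δ →
      l (symmDiff (Prod.mk b ⁻¹' W) (Prod.mk b' ⁻¹' W)) ≤ h b + h b' + ENNReal.ofReal ε := by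
  let := upgradeStandardBorel Y
  have hint : Integrable (W.indicator (fun _ => (1 : ℝ))) (ν.prod l) :=
    (integrable_const 1).indicator hW
  -- The error `h b` is the `L¹` distance, over the section at `b`, from the indicator of `W` to a
  -- continuous approximation `f`.
  obtain ⟨f, hf, -⟩ := hint.exists_boundedContinuous_lintegral_sub_le
    (ε := ENNReal.ofReal ε) (by simpa using hε)
  have hmeas : Measurable fun p : B × Y => ‖W.indicator (fun _ => (1 : ℝ)) p - f p‖ₑ :=
    ((measurable_const.indicator hW).sub f.continuous.measurable).enorm
  refine ⟨fun b => ∫⁻ y, ‖W.indicator (fun _ => (1 : ℝ)) (b, y) - f (b, y)‖ₑ ∂l,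
    hmeas.lintegral_prod_right', ?_, ?_⟩
  · rwa [lintegral_prod _ hmeas.aemeasurable] at hf
  have hcont : Continuous fun q : B × B => ∫ y, ‖f (q.1, y) - f (q.2, y)‖ ∂l := by
    refine continuous_of_dominated (bound := fun _ => ‖f‖ + ‖f‖) (fun q => ?_) (fun q => ?_)
      (integrable_const _) (Eventually.of_forall fun y => by fun_prop)
    · exact (Continuous.aestronglyMeasurable (by fun_prop))
    · refine Eventually.of_forall fun y => ?_
      rw [norm_norm]
      exact (norm_sub_le _ _).trans (add_le_add (f.norm_coe_le_norm _) (f.norm_coe_le_norm _))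
  -- As `B` is compact, a neighbourhood of the diagonal is an entourage, which gives a uniform `δ`.
  have hU : {q : B × B | ∫ y, ‖f (q.1, y) - f (q.2, y)‖ ∂l < ε} ∈ uniformity B := by
    rw [← nhdsSet_diagonal_eq_uniformity]
    refine (isOpen_lt hcont continuous_const).mem_nhdsSet.2 ?_
    rintro ⟨b, b'⟩ hb
    obtain rfl : b = b' := hb
    simpa using hε
  obtain ⟨δ, hδ, hδU⟩ := Metric.mem_uniformity_dist.1 hU
  refine ⟨δ, hδ, fun b b' hbb => ?_⟩
  have hsmall : ∫ y, ‖f (b, y) - f (b', y)‖ ∂l < ε := hδU hbb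
  have hfm : ∀ b, Measurable fun y => f (b, y) := fun b =>
    f.continuous.measurable.comp measurable_prodMk_left
  have hint2 : Integrable (fun y => f (b, y) - f (b', y)) l :=
    (Integrable.of_bound (hfm b).aestronglyMeasurable ‖f‖
      (Eventually.of_forall fun y => f.norm_coe_le_norm _)).sub
    (Integrable.of_bound (hfm b').aestronglyMeasurable ‖f‖
      (Eventually.of_forall fun y => f.norm_coe_le_norm _))
  have h3 : ∫⁻ y, ‖f (b, y) - f (b', y)‖ₑ ∂l ≤ ENNReal.ofReal ε := by
    rw [← ofReal_integral_norm_eq_lintegral_enorm hint2]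
    exact ENNReal.ofReal_le_ofReal hsmall.le
  have hms : MeasurableSet (symmDiff (Prod.mk b ⁻¹' W) (Prod.mk b' ⁻¹' W)) :=
    (measurable_prodMk_left hW).symmDiff (measurable_prodMk_left hW)
  have hm1 : ∀ b, Measurable fun y => ‖W.indicator (fun _ => (1 : ℝ)) (b, y) - f (b, y)‖ₑ :=
    fun b => hmeas.comp measurable_prodMk_left
  calc l (symmDiff (Prod.mk b ⁻¹' W) (Prod.mk b' ⁻¹' W))
      = ∫⁻ y, (symmDiff (Prod.mk b ⁻¹' W) (Prod.mk b' ⁻¹' W)).indicator 1 y ∂l := by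
        rw [lintegral_indicator_one hms]
    _ ≤ ∫⁻ y, (‖W.indicator (fun _ => (1 : ℝ)) (b, y) - f (b, y)‖ₑ +
          ‖W.indicator (fun _ => (1 : ℝ)) (b', y) - f (b', y)‖ₑ +
          ‖f (b, y) - f (b', y)‖ₑ) ∂l := by
        refine lintegral_mono fun y => ?_
        set u : B → ℝ := fun b => W.indicator (fun _ => (1 : ℝ)) (b, y) with hu
        have key : ‖u b - u b'‖ₑ ≤ ‖u b - f (b, y)‖ₑ + ‖u b' - f (b', y)‖ₑ +
            ‖f (b, y) - f (b', y)‖ₑ := by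
          have e : u b - u b' = (u b - f (b, y)) - (u b' - f (b', y)) +
            (f (b, y) - f (b', y)) := by ring
          rw [e]
          exact (enorm_add_le _ _).trans (add_le_add (enorm_sub_le) le_rfl)
        refine le_trans ?_ key
        refine Set.indicator_apply_le' (fun hy => ?_) (fun _ => zero_le)
        rcases hy with ⟨h1, h2⟩ | ⟨h1, h2⟩ <;> simp only [Set.mem_preimage] at h1 h2 <;>
          simp [hu, h1, h2]
    _ ≤ _ := by
        rw [lintegral_add_left ((hm1 b).fun_add (hm1 b')), lintegral_add_left (hm1 b)]
        gcongr

/-! ### Radon–Nikodym derivatives. -/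

/-- The change of variables formula for the Radon-Nikodym derivative of a nonsingular action. -/
theorem lintegral_smul_mul_rnDerivAction {Γ B : Type*} [Group Γ] [MeasurableSpace B]
    [MulAction Γ B] {ν : Measure B} [IsProbabilityMeasure ν] (hν : IsNonsingular Γ ν) (g : Γ)
    {φ : B → ℝ≥0∞} (hφ : Measurable φ) :
    ∫⁻ c, φ (g • c) * rnDerivAction ν g c ∂ν = ∫⁻ b, φ b ∂ν := by
  have hm := (hν g).measurable
  have h := lintegral_rnDeriv_mul (hν g⁻¹).absolutelyContinuous (hφ.comp hm).aemeasurable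
  rw [lintegral_map (hφ.comp hm) (hν g⁻¹).measurable] at h
  simpa [rnDerivAction, mul_comm] using h

theorem rnDerivAction_pos {Γ B : Type*} [Group Γ] [MeasurableSpace B]
    [MulAction Γ B] {ν : Measure B} [IsProbabilityMeasure ν] (hν : IsNonsingular Γ ν) (g : Γ) :
    ∀ᵐ b ∂ν, 0 < rnDerivAction ν g b := by
  refine Measure.rnDeriv_pos' ?_
  have h := (hν g).absolutelyContinuous.map (hν g⁻¹).measurable
  rw [Measure.map_map (hν g⁻¹).measurable (hν g).measurable] at h
  simpa [Function.comp_def] using h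

/-- The derivative is almost everywhere positive and finite, so no default value of `toReal` or
`Real.log` interferes. -/
theorem exp_eq_rnDerivAction {Γ B : Type*} [Group Γ] [MeasurableSpace B]
    [MulAction Γ B] {ν : Measure B} [IsProbabilityMeasure ν] (hν : IsNonsingular Γ ν)
    {R : Γ → B → ℝ} (hR : IsLogRNCocycle ν R) (g : Γ) :
    ∀ᵐ b ∂ν, (rnDerivAction ν g b).toReal = Real.exp (R g b) := by
  filter_upwards [rnDerivAction_pos hν g, Measure.rnDeriv_ne_top (ν.map fun b : B => g⁻¹ • b) ν,
    hR.ae_eq g] with b h1 h2 h3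
  rw [h3, Real.exp_log (ENNReal.toReal_pos h1.ne' h2)]

theorem rnDerivAction_prod {Γ B X : Type*} [Group Γ] [MeasurableSpace B]
    [MulAction Γ B] {ν : Measure B} [IsProbabilityMeasure ν] (hν : IsNonsingular Γ ν)
    [MeasurableSpace X] [MulAction Γ X] {μ : Measure X} [IsProbabilityMeasure μ]
    (hμ : IsMeasurePreserving Γ μ) (g : Γ) :
    ∀ᵐ p ∂(ν.prod μ), rnDerivAction (ν.prod μ) g p = rnDerivAction ν g p.1 := by
  have e : (ν.prod μ).map (fun p : B × X => g⁻¹ • p) =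
      (ν.prod μ).withDensity fun p => rnDerivAction ν g p.1 := by
    have h1 := Measure.map_prod_map ν μ (hν g⁻¹).measurable (hμ g⁻¹).measurable
    have h2 : (fun p : B × X => g⁻¹ • p) =
      Prod.map (fun b : B => g⁻¹ • b) (fun x : X => g⁻¹ • x) := rfl
    rw [h2, ← h1, (hμ g⁻¹).map_eq]
    conv_lhs => rw [← Measure.withDensity_rnDeriv_eq _ _ (hν g⁻¹).absolutelyContinuous]
    rw [prod_withDensity_left (Measure.measurable_rnDeriv _ _)]
    rfl
  rw [rnDerivAction, e]
  exact Measure.rnDeriv_withDensity _ ((Measure.measurable_rnDeriv _ _).comp measurable_fst)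

theorem tsum_lintegral_mul_le {Γ B : Type*} [Countable Γ] [MeasurableSpace B] {ν : Measure B}
    {w : Γ → B → ℝ≥0∞} (hw : ∀ g, Measurable (w g)) {C : ℝ≥0∞}
    (hC : ∀ᵐ b ∂ν, ∑' g, w g b ≤ C) {h : B → ℝ≥0∞} (hh : Measurable h) :
    ∑' g, ∫⁻ b, h b * w g b ∂ν ≤ C * ∫⁻ b, h b ∂ν := by
  rw [← lintegral_tsum fun g => (hh.fun_mul (hw g)).aemeasurable, ← lintegral_const_mul _ hh]
  refine lintegral_mono_ae ?_
  filter_upwards [hC] with b hb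
  rw [ENNReal.tsum_mul_left, mul_comm]
  gcongr

/-! ### Averages against an admissible family. -/

section Averaging

variable {Γ : Type*} [Group Γ] [Countable Γ] {B : Type*} [MetricSpace B] [CompactSpace B]
  [MeasurableSpace B] [BorelSpace B] [MulAction Γ B] {ν : Measure B} [IsProbabilityMeasure ν]
  {R : Γ → B → ℝ} {Υ : ℕ → Γ → B → B → ℝ≥0}

namespace IsAdmissibleFamily

variable (hΥ : IsAdmissibleFamily ν R Υ) (n : ℕ)
include hΥ

omit [Countable Γ] [CompactSpace B] [BorelSpace B] [IsProbabilityMeasure ν] in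
theorem measurable_coe (g : Γ) : Measurable fun p : B × B => (Υ n g p.1 p.2 : ℝ≥0∞) :=
  (hΥ.measurable n g).coe_nnreal_ennreal

omit [Countable Γ] [CompactSpace B] [BorelSpace B] [IsProbabilityMeasure ν] in
theorem measurable_coe_right (g : Γ) (b : B) : Measurable fun b' => (Υ n g b b' : ℝ≥0∞) :=
  (hΥ.measurable_coe n g).comp measurable_prodMk_left

omit [Countable Γ] [CompactSpace B] [BorelSpace B] [IsProbabilityMeasure ν] in
theorem measurable_coe_left (g : Γ) (b' : B) : Measurable fun b => (Υ n g b b' : ℝ≥0∞) :=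
  (hΥ.measurable_coe n g).comp measurable_prodMk_right

/-- This and the next three lemmas control the images of the measure with density `Υ n` under `b`,
`b'`, `g⁻¹ b` and `g⁻¹ b'`. The first is `ν` by normalization; the others are at most `C ν` by the
three integral bounds, the last two after a change of variables by `g`. A function with small
`ν`-integral therefore stays small on average at all four points. -/
theorem tsum_lintegral_fst {h : B → ℝ≥0∞} (hh : Measurable h) :
    ∑' g, ∫⁻ p, h p.1 * (Υ n g p.1 p.2 : ℝ≥0∞) ∂(ν.prod ν) = ∫⁻ b, h b ∂ν := by
  have hm := hΥ.measurable_coe n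
  have e : ∀ g, ∫⁻ p, h p.1 * (Υ n g p.1 p.2 : ℝ≥0∞) ∂(ν.prod ν) =
      ∫⁻ b, h b * ∫⁻ b', (Υ n g b b' : ℝ≥0∞) ∂ν ∂ν := fun g => by
    rw [lintegral_prod _ ((hh.fun_comp measurable_fst).fun_mul (hm g)).aemeasurable]
    exact lintegral_congr fun b => lintegral_const_mul (h _) (hΥ.measurable_coe_right n g b)
  simp_rw [e]
  rw [← lintegral_tsum fun g => (hh.fun_mul (hm g).lintegral_prod_right').aemeasurable]
  simp_rw [ENNReal.tsum_mul_left, hΥ.sum_eq_one n, mul_one]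

theorem tsum_lintegral_snd_le {C : ℝ≥0∞}
    (hC : ∀ᵐ b' ∂ν, ∫⁻ b, ∑' g, (Υ n g b b' : ℝ≥0∞) ∂ν ≤ C) {h : B → ℝ≥0∞} (hh : Measurable h) :
    ∑' g, ∫⁻ p, h p.2 * (Υ n g p.1 p.2 : ℝ≥0∞) ∂(ν.prod ν) ≤ C * ∫⁻ b, h b ∂ν := by
  have hm := hΥ.measurable_coe n
  have e : ∀ g, ∫⁻ p, h p.2 * (Υ n g p.1 p.2 : ℝ≥0∞) ∂(ν.prod ν) =
      ∫⁻ b', h b' * ∫⁻ b, (Υ n g b b' : ℝ≥0∞) ∂ν ∂ν := fun g => by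
    rw [lintegral_prod_symm _ ((hh.fun_comp measurable_snd).fun_mul (hm g)).aemeasurable]
    exact lintegral_congr fun b' => lintegral_const_mul (h _) (hΥ.measurable_coe_left n g b')
  simp_rw [e]
  refine tsum_lintegral_mul_le (fun g => (hm g).lintegral_prod_left') ?_ hh
  filter_upwards [hC] with b' hb'
  rwa [← lintegral_tsum fun g => (hΥ.measurable_coe_left n g _).aemeasurable]

theorem tsum_lintegral_inv_smul_fst_le (hν : IsNonsingular Γ ν) {C : ℝ≥0∞}
    (hC : ∀ᵐ b ∂ν, ∫⁻ b', ∑' g, (Υ n g (g • b) b' : ℝ≥0∞) * rnDerivAction ν g b ∂ν ≤ C)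
    {h : B → ℝ≥0∞} (hh : Measurable h) :
    ∑' g, ∫⁻ p, h (g⁻¹ • p.1) * (Υ n g p.1 p.2 : ℝ≥0∞) ∂(ν.prod ν) ≤ C * ∫⁻ b, h b ∂ν := by
  have hm := hΥ.measurable_coe n
  have hr : ∀ g : Γ, Measurable (rnDerivAction ν g) := fun g => Measure.measurable_rnDeriv _ _
  have e : ∀ g, ∫⁻ p, h (g⁻¹ • p.1) * (Υ n g p.1 p.2 : ℝ≥0∞) ∂(ν.prod ν) =
      ∫⁻ c, h c * ((∫⁻ b', (Υ n g (g • c) b' : ℝ≥0∞) ∂ν) * rnDerivAction ν g c) ∂ν := fun g => by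
    have hhg : Measurable fun b => h (g⁻¹ • b) := hh.comp (hν g⁻¹).measurable
    rw [lintegral_prod _ ((hhg.fun_comp measurable_fst).fun_mul (hm g)).aemeasurable]
    have h1 := lintegral_smul_mul_rnDerivAction hν g (hhg.fun_mul ((hm g).lintegral_prod_right' (ν := ν)))
    simp only [inv_smul_smul] at h1
    simp_rw [← mul_assoc]
    rw [h1]
    exact lintegral_congr fun b => lintegral_const_mul (h _) (hΥ.measurable_coe_right n g b)
  simp_rw [e]
  refine tsum_lintegral_mul_le (fun g =>
    ((hm g).lintegral_prod_right'.fun_comp (hν g).measurable).fun_mul (hr g)) ?_ hh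
  filter_upwards [hC] with c hc
  rw [lintegral_tsum fun g =>
    ((hΥ.measurable_coe_right n g _).mul_const _).aemeasurable] at hc
  refine le_of_eq_of_le (tsum_congr fun g => ?_) hc
  exact (lintegral_mul_const _ (hΥ.measurable_coe_right n g _)).symm

theorem tsum_lintegral_inv_smul_snd_le (hν : IsNonsingular Γ ν) {C : ℝ≥0∞}
    (hC : ∀ᵐ b' ∂ν, ∫⁻ b, ∑' g, (Υ n g b (g • b') : ℝ≥0∞) * rnDerivAction ν g b' ∂ν ≤ C)
    {h : B → ℝ≥0∞} (hh : Measurable h) :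
    ∑' g, ∫⁻ p, h (g⁻¹ • p.2) * (Υ n g p.1 p.2 : ℝ≥0∞) ∂(ν.prod ν) ≤ C * ∫⁻ b, h b ∂ν := by
  have hm := hΥ.measurable_coe n
  have hr : ∀ g : Γ, Measurable (rnDerivAction ν g) := fun g => Measure.measurable_rnDeriv _ _
  have e : ∀ g, ∫⁻ p, h (g⁻¹ • p.2) * (Υ n g p.1 p.2 : ℝ≥0∞) ∂(ν.prod ν) =
      ∫⁻ c, h c * ((∫⁻ b, (Υ n g b (g • c) : ℝ≥0∞) ∂ν) * rnDerivAction ν g c) ∂ν := fun g => by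
    have hhg : Measurable fun b => h (g⁻¹ • b) := hh.comp (hν g⁻¹).measurable
    rw [lintegral_prod_symm _ ((hhg.fun_comp measurable_snd).fun_mul (hm g)).aemeasurable]
    have h1 := lintegral_smul_mul_rnDerivAction hν g (hhg.fun_mul ((hm g).lintegral_prod_left' (μ := ν)))
    simp only [inv_smul_smul] at h1
    simp_rw [← mul_assoc]
    rw [h1]
    exact lintegral_congr fun b => lintegral_const_mul (h _) (hΥ.measurable_coe_left n g b)
  simp_rw [e]
  refine tsum_lintegral_mul_le (fun g =>
    ((hm g).lintegral_prod_left'.fun_comp (hν g).measurable).fun_mul (hr g)) ?_ hh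
  filter_upwards [hC] with c hc
  rw [lintegral_tsum fun g =>
    ((hΥ.measurable_coe_left n g _).mul_const _).aemeasurable] at hc
  refine le_of_eq_of_le (tsum_congr fun g => ?_) hc
  exact (lintegral_mul_const _ (hΥ.measurable_coe_left n g _)).symm

omit n in
/-- An admissible family asymptotically does not see the difference between the sections of a
measurable set, neither at `(b, b')` nor at `(g⁻¹ b, g⁻¹ b')`. -/
theorem tendsto_lintegral_symmDiff_section (hν : IsNonsingular Γ ν) {Y : Type*}
    [MeasurableSpace Y] [StandardBorelSpace Y] (l : Measure Y) [IsFiniteMeasure l]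
    {W : Set (B × Y)} (hW : MeasurableSet W) :
    Tendsto (fun n => ∑' g, ∫⁻ p : B × B,
      (l (symmDiff (Prod.mk p.1 ⁻¹' W) (Prod.mk p.2 ⁻¹' W)) +
        l (symmDiff (Prod.mk (g⁻¹ • p.1) ⁻¹' W) (Prod.mk (g⁻¹ • p.2) ⁻¹' W))) *
        (Υ n g p.1 p.2 : ℝ≥0∞) ∂(ν.prod ν)) atTop (𝓝 0) := by
  obtain ⟨C, -, hC⟩ := hΥ.integral_bound
  obtain ⟨β, hβ, hdist⟩ := hΥ.dist_le
  rw [ENNReal.tendsto_nhds_zero]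
  intro ε hε
  obtain ⟨r, hr, hrε⟩ : ∃ r : ℝ≥0, 0 < r ∧ (r : ℝ≥0∞) < ε := ENNReal.lt_iff_exists_nnreal_btwn.1 hε
    |>.imp fun r h => ⟨by simpa using h.1, h.2⟩
  -- The total error is `(1 + 3 C) η` from the four values of `h`, plus `2 η` from the two uniform
  -- errors.
  set η : ℝ≥0 := r / (3 + 3 * C) with hη
  have hη0 : 0 < η := by positivity
  obtain ⟨h, hh, hint, δ, hδ, hD⟩ := exists_symmDiff_section_le ν l hW (ε := (η : ℝ)) (by simpa)
  rw [ENNReal.ofReal_coe_nnreal] at hint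
  filter_upwards [hβ.eventually_lt_const hδ] with n hn
  obtain ⟨hC1, hC2, hC3⟩ := hC n
  have hm := hΥ.measurable_coe n
  have m1 : ∀ g, Measurable fun p : B × B => h p.1 * (Υ n g p.1 p.2 : ℝ≥0∞) := fun g =>
    (hh.comp measurable_fst).mul (hm g)
  have m2 : ∀ g, Measurable fun p : B × B => h p.2 * (Υ n g p.1 p.2 : ℝ≥0∞) := fun g =>
    (hh.comp measurable_snd).mul (hm g)
  have m3 : ∀ g, Measurable fun p : B × B => h (g⁻¹ • p.1) * (Υ n g p.1 p.2 : ℝ≥0∞) := fun g =>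
    (hh.comp ((hν g⁻¹).measurable.comp measurable_fst)).mul (hm g)
  have m4 : ∀ g, Measurable fun p : B × B => h (g⁻¹ • p.2) * (Υ n g p.1 p.2 : ℝ≥0∞) := fun g =>
    (hh.comp ((hν g⁻¹).measurable.comp measurable_snd)).mul (hm g)
  calc _ ≤ ∑' g, ∫⁻ p : B × B, (h p.1 * (Υ n g p.1 p.2 : ℝ≥0∞) + h p.2 * (Υ n g p.1 p.2 : ℝ≥0∞) +
          h (g⁻¹ • p.1) * (Υ n g p.1 p.2 : ℝ≥0∞) + h (g⁻¹ • p.2) * (Υ n g p.1 p.2 : ℝ≥0∞) +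
          2 * η * (Υ n g p.1 p.2 : ℝ≥0∞)) ∂(ν.prod ν) := by
        refine ENNReal.tsum_le_tsum fun g => lintegral_mono fun p => ?_
        rcases eq_or_ne (Υ n g p.1 p.2) 0 with h0 | h0
        · simp [h0]
        obtain ⟨d1, d2⟩ := hdist n g p.1 p.2 (pos_iff_ne_zero.2 h0)
        have e1 := hD _ _ (d1.trans_lt hn)
        have e2 := hD _ _ (d2.trans_lt hn)
        rw [ENNReal.ofReal_coe_nnreal] at e1 e2
        simp only [← add_mul]
        refine mul_le_mul_left ((add_le_add e1 e2).trans_eq ?_) _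
        ring
    _ = ∑' g, ∫⁻ p : B × B, h p.1 * (Υ n g p.1 p.2 : ℝ≥0∞) ∂(ν.prod ν) +
        ∑' g, ∫⁻ p : B × B, h p.2 * (Υ n g p.1 p.2 : ℝ≥0∞) ∂(ν.prod ν) +
        ∑' g, ∫⁻ p : B × B, h (g⁻¹ • p.1) * (Υ n g p.1 p.2 : ℝ≥0∞) ∂(ν.prod ν) +
        ∑' g, ∫⁻ p : B × B, h (g⁻¹ • p.2) * (Υ n g p.1 p.2 : ℝ≥0∞) ∂(ν.prod ν) +
        ∑' g, ∫⁻ p : B × B, 2 * η * (Υ n g p.1 p.2 : ℝ≥0∞) ∂(ν.prod ν) := by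
        simp only [← ENNReal.tsum_add]
        refine tsum_congr fun g => ?_
        rw [lintegral_add_left ((((m1 g).fun_add (m2 g)).fun_add (m3 g)).fun_add (m4 g)),
          lintegral_add_left (((m1 g).fun_add (m2 g)).fun_add (m3 g)),
          lintegral_add_left ((m1 g).fun_add (m2 g)), lintegral_add_left (m1 g)]
    _ ≤ η + C * η + C * η + C * η + 2 * η := by
        gcongr
        · exact (hΥ.tsum_lintegral_fst n hh).trans_le hint
        · exact (hΥ.tsum_lintegral_snd_le n hC1 hh).trans (by gcongr)
        · exact (hΥ.tsum_lintegral_inv_smul_fst_le n hν hC3 hh).trans (by gcongr)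
        · exact (hΥ.tsum_lintegral_inv_smul_snd_le n hν hC2 hh).trans (by gcongr)
        · exact (hΥ.tsum_lintegral_fst n (h := fun _ => 2 * η) measurable_const).trans_le (by simp)
    _ = r := by
        norm_cast
        rw [hη]
        field_simp
        ring
    _ ≤ ε := hrε.le

end IsAdmissibleFamily

end Averaging

/-! ### Product actions and saturations in the Maharam extension. -/

theorem IsNonsingular.prod {Γ B X : Type*} [Group Γ] [MeasurableSpace B] [MulAction Γ B]
    {ν : Measure B} [SFinite ν] (hν : IsNonsingular Γ ν) [MeasurableSpace X] [MulAction Γ X]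
    {μ : Measure X} [SFinite μ] (hμ : IsNonsingular Γ μ) : IsNonsingular Γ (ν.prod μ) := fun g => by
  refine ⟨(hν g).measurable.prodMap (hμ g).measurable, ?_⟩
  change (ν.prod μ).map (Prod.map (fun b : B => g • b) (fun x : X => g • x)) ≪ _
  rw [← Measure.map_prod_map ν μ (hν g).measurable (hμ g).measurable]
  exact (hν g).absolutelyContinuous.prod (hμ g).absolutelyContinuous

theorem IsMeasurePreserving.isNonsingular {Γ X : Type*} [Group Γ] [MeasurableSpace X]
    [MulAction Γ X] {μ : Measure X} (hμ : IsMeasurePreserving Γ μ) : IsNonsingular Γ μ :=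
  fun g => (hμ g).quasiMeasurePreserving

theorem IsLogRNCocycle.map_one {Γ B : Type*} [Group Γ] [MeasurableSpace B] [MulAction Γ B]
    {ν : Measure B} {R : Γ → B → ℝ} (hR : IsLogRNCocycle ν R) (b : B) : R 1 b = 0 := by
  have := hR.cocycle 1 1 b
  simp at this
  linarith

/-- The saturation of `A × [0, η)` in the Maharam extension of the action on `B × X`. -/
def maharamSaturation {Γ B X : Type*} [Group Γ] [MulAction Γ B] [MulAction Γ X]
    (R : Γ → B → ℝ) (A : Set (B × X)) (η : ℝ) : Set (B × (X × ℝ)) :=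
  {q | ∃ g : Γ, g • (q.1, q.2.1) ∈ A ∧ q.2.2 + R g q.1 ∈ Set.Ico 0 η}

/-- The points of `B × X` that return to `A` along an element at which the cocycle is at most
`M` in absolute value. -/
def boundedSaturation {Γ B X : Type*} [Group Γ] [MulAction Γ B] [MulAction Γ X]
    (R : Γ → B → ℝ) (A : Set (B × X)) (M : ℝ) : Set (B × X) :=
  {p | ∃ g : Γ, g • p ∈ A ∧ |R g p.1| ≤ M}

section Saturation

variable {Γ : Type*} [Group Γ] {B : Type*} [MeasurableSpace B] [MulAction Γ B] {ν : Measure B}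
  {R : Γ → B → ℝ} {X : Type*} [MeasurableSpace X] [MulAction Γ X] {A : Set (B × X)}

theorem measurableSet_maharamSaturation [Countable Γ] (hR : IsLogRNCocycle ν R)
    (hm : ∀ g : Γ, Measurable fun p : B × X => g • p) (hA : MeasurableSet A) (η : ℝ) :
    MeasurableSet (maharamSaturation R A η) := by
  have e : maharamSaturation R A η = ⋃ g : Γ,
      (fun q : B × (X × ℝ) => g • (q.1, q.2.1)) ⁻¹' A ∩
        (fun q : B × (X × ℝ) => q.2.2 + R g q.1) ⁻¹' Set.Ico 0 η := by
    ext q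
    simp [maharamSaturation]
  rw [e]
  refine MeasurableSet.iUnion fun g => (((hm g).comp (by fun_prop)) hA).inter ?_
  have := hR.measurable g
  exact (by fun_prop : Measurable fun q : B × (X × ℝ) => q.2.2 + R g q.1) measurableSet_Ico

theorem measurableSet_boundedSaturation [Countable Γ] (hR : IsLogRNCocycle ν R)
    (hm : ∀ g : Γ, Measurable fun p : B × X => g • p) (hA : MeasurableSet A) (M : ℝ) :
    MeasurableSet (boundedSaturation R A M) := by
  have e : boundedSaturation R A M = ⋃ g : Γ,
      (fun p : B × X => g • p) ⁻¹' A ∩ {p | |R g p.1| ≤ M} := by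
    ext q
    simp [boundedSaturation]
  rw [e]
  refine MeasurableSet.iUnion fun g => ((hm g) hA).inter ?_
  have := hR.measurable g
  exact measurableSet_le (by fun_prop) measurable_const

-- Invariance under the Maharam action: the witness `g` is replaced by `g * h` or `g * h⁻¹`, and the
-- cocycle identity adjusts the real coordinate.
omit [MeasurableSpace X] in
theorem smul_mem_maharamSaturation_iff (hR : IsLogRNCocycle ν R) (η : ℝ) (h : Γ) (b : B) (x : X)
    (t : ℝ) : (h • b, (h • x, t + R h b)) ∈ maharamSaturation R A η ↔
      (b, (x, t)) ∈ maharamSaturation R A η := by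
  constructor
  · rintro ⟨g, h1, h2⟩
    refine ⟨g * h, ?_, ?_⟩
    · simpa [mul_smul] using h1
    · simp only [hR.cocycle] at h2 ⊢
      convert h2 using 1
      ring
  · rintro ⟨g, h1, h2⟩
    refine ⟨g * h⁻¹, ?_, ?_⟩
    · simpa [mul_smul] using h1
    · have := hR.cocycle (g * h⁻¹) h b
      simp only [inv_mul_cancel_right] at this
      simp only at h2 ⊢
      rw [this] at h2
      convert h2 using 1
      ring

omit [MeasurableSpace X] in
/-- If the return cocycle of `A` avoids the `2 η`-neighbourhood of `T`, then the section of the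
saturation of `A × [0, η)` at a point that returns to `A` is moved by all translations near `T`. -/
theorem le_volume_translate_maharamSaturation (hR : IsLogRNCocycle ν R) {η T : ℝ}
    (hη : η ≤ 1) (hsep : ∀ p ∈ A, ∀ g : Γ, g • p ∈ A → 2 * η ≤ |R g p.1 - T|) {M : ℝ}
    {b : B} {x : X} (hp : (b, x) ∈ boundedSaturation R A M) {τ : ℝ} (hτ : |τ - T| < η) :
    ENNReal.ofReal η ≤ volume {t : ℝ | t ∈ Set.Icc (-(M + 1)) (M + 1) ∧
      ¬ ((b, (x, t)) ∈ maharamSaturation R A η ↔ (b, (x, t - τ)) ∈ maharamSaturation R A η)} := by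
  obtain ⟨g, hgA, hgM⟩ := hp
  -- The return `g` puts this interval in the fibre of the saturation. If the translate by `τ` also
  -- met the fibre, through `h`, then `h * g⁻¹` would be a return to `A` with cocycle within `2 η`
  -- of `T`. The window has radius `M + 1` because `|R g b| ≤ M` and `η ≤ 1`.
  have hsub : Set.Ico (-R g b) (-R g b + η) ⊆ {t : ℝ | t ∈ Set.Icc (-(M + 1)) (M + 1) ∧
      ¬ ((b, (x, t)) ∈ maharamSaturation R A η ↔ (b, (x, t - τ)) ∈ maharamSaturation R A η)} := by
    rintro t ⟨ht1, ht2⟩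
    obtain ⟨hM1, hM2⟩ := abs_le.1 hgM
    simp only at hM1 hM2
    refine ⟨⟨by linarith, by linarith⟩, fun hiff => ?_⟩
    obtain ⟨h, hhA, hh1, hh2⟩ := hiff.1 ⟨g, hgA, by simp only; linarith, by simp only; linarith⟩
    simp only at hhA hh1 hh2
    have h1 := hsep _ hgA (h * g⁻¹) (by simpa [mul_smul] using hhA)
    have h2 := hR.cocycle (h * g⁻¹) g b
    simp only [inv_mul_cancel_right] at h2
    change 2 * η ≤ |R (h * g⁻¹) (g • b) - T| at h1
    obtain ⟨h3, h4⟩ := abs_lt.1 hτ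
    refine absurd h1 (not_le.2 (abs_lt.2 ⟨?_, ?_⟩)) <;> linarith
  calc ENNReal.ofReal η = volume (Set.Ico (-R g b) (-R g b + η)) := by simp
    _ ≤ _ := measure_mono hsub

/-- Translating the section over `b` of the saturation by the difference of the cocycle at two
points changes it as little as the sections over those points and their images differ. -/
theorem measure_translate_maharamSaturation_le [Countable Γ] (hR : IsLogRNCocycle ν R)
    (hm : ∀ g : Γ, Measurable fun p : B × X => g • p) (hA : MeasurableSet A) (η : ℝ)
    {μ : Measure X} [IsProbabilityMeasure μ] (hμ : IsMeasurePreserving Γ μ) (g : Γ) {b b' : B}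
    {C K : ℝ} (hC : |R g b| + |R g b'| ≤ C) :
    (μ.prod volume) {q : X × ℝ | q.2 ∈ Set.Icc (-K) K ∧
      ¬ ((b, q) ∈ maharamSaturation R A η ↔
        (b, (q.1, q.2 - (R g b' - R g b))) ∈ maharamSaturation R A η)} ≤
    (μ.prod (volume.restrict (Set.Icc (-(K + C)) (K + C))))
      (symmDiff (Prod.mk b ⁻¹' maharamSaturation R A η)
        (Prod.mk b' ⁻¹' maharamSaturation R A η)) +
    (μ.prod (volume.restrict (Set.Icc (-(K + C)) (K + C))))
      (symmDiff (Prod.mk (g • b) ⁻¹' maharamSaturation R A η)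
        (Prod.mk (g • b') ⁻¹' maharamSaturation R A η)) := by
  set W := maharamSaturation R A η with hWdef
  have hW : MeasurableSet W := measurableSet_maharamSaturation hR hm hA η
  have hsec : ∀ b, MeasurableSet (Prod.mk b ⁻¹' W) := fun b => measurable_prodMk_left hW
  set I := Set.Icc (-(K + C)) (K + C) with hI
  have hl : ∀ S : Set (X × ℝ), MeasurableSet S →
      (μ.prod (volume.restrict I)) S = (μ.prod volume) (S ∩ Set.univ ×ˢ I) := fun S hS => by
    conv_lhs => rw [← Measure.restrict_univ (μ := μ), Measure.prod_restrict,
      Measure.restrict_apply hS]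
  have hθ : MeasurePreserving (fun q : X × ℝ => (g • q.1, q.2 + R g b))
      (μ.prod volume) (μ.prod volume) :=
    (hμ g).prod (measurePreserving_add_right volume (R g b))
  have hσ : MeasurePreserving (fun q : X × ℝ => (q.1, q.2 - (R g b' - R g b)))
      (μ.prod volume) (μ.prod volume) :=
    (MeasurePreserving.id μ).prod (measurePreserving_sub_right volume (R g b' - R g b))
  have hm1 := (hsec b).symmDiff (hsec b')
  have hm2 := (hsec (g • b)).symmDiff (hsec (g • b'))
  have hms : MeasurableSet (Set.univ ×ˢ I : Set (X × ℝ)) := MeasurableSet.univ.prod measurableSet_Icc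
  rw [hl _ hm1, hl _ hm2, ← hσ.measure_preimage (hm1.inter hms).nullMeasurableSet,
    ← hθ.measure_preimage (hm2.inter hms).nullMeasurableSet]
  refine (measure_mono ?_).trans (measure_union_le _ _)
  rintro ⟨x, t⟩ ⟨⟨ht1, ht2⟩, hne⟩
  simp only at ht1 ht2 hne
  -- The translation is chosen so that `(x, t)` over `b` and its translate over `b'` are carried by
  -- `g` to the same point of `X × ℝ`. A discrepancy must therefore show up between `b` and `b'` or
  -- between `g b` and `g b'`.
  have e1 := smul_mem_maharamSaturation_iff (A := A) hR η g b x t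
  have e2 := smul_mem_maharamSaturation_iff (A := A) hR η g b' x (t - (R g b' - R g b))
  rw [show t - (R g b' - R g b) + R g b' = t + R g b by ring] at e2
  rw [← hWdef] at e1 e2
  have hb := abs_nonneg (R g b)
  have hb' := abs_nonneg (R g b')
  -- Both shifts are at most `C` in absolute value, so a window of radius `K + C` suffices.
  have hI1 : t - (R g b' - R g b) ∈ I := by
    constructor <;> linarith [neg_abs_le (R g b), le_abs_self (R g b), neg_abs_le (R g b'),
      le_abs_self (R g b')]
  have hI2 : t + R g b ∈ I := by
    constructor <;> linarith [neg_abs_le (R g b), le_abs_self (R g b)]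
  by_cases h : (b, (x, t - (R g b' - R g b))) ∈ W ↔ (b', (x, t - (R g b' - R g b))) ∈ W
  · refine Or.inr ⟨?_, trivial, hI2⟩
    simp only [Set.mem_symmDiff, Set.mem_preimage]
    tauto
  · refine Or.inl ⟨?_, trivial, hI1⟩
    simp only [Set.mem_symmDiff, Set.mem_preimage]
    tauto

end Saturation

/-! ### Returns with cocycle near `T`. -/

section Return

variable {Γ : Type*} [Group Γ] [Countable Γ] {B : Type*} [MetricSpace B] [CompactSpace B]
  [MeasurableSpace B] [BorelSpace B] [MulAction Γ B] {ν : Measure B} [IsProbabilityMeasure ν]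
  {R : Γ → B → ℝ} {Υ : ℕ → Γ → B → B → ℝ≥0}
  {X : Type*} [MeasurableSpace X] [StandardBorelSpace X] [MulAction Γ X] {μ : Measure X}
  [IsProbabilityMeasure μ] {A : Set (B × X)}

omit [Countable Γ] [CompactSpace B] [BorelSpace B] in
theorem zeta_apply_prod (hR : IsLogRNCocycle ν R) (hΥ : IsAdmissibleFamily ν R Υ) (n : ℕ)
    {E : Set ℝ} (hE : MeasurableSet E) :
    zeta ν R Υ n E = ∑' g : Γ, ∫⁻ p : B × B,
      E.indicator 1 (R g⁻¹ p.2 - R g⁻¹ p.1) * (Υ n g p.1 p.2 : ℝ≥0∞) ∂(ν.prod ν) := by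
  rw [zeta_apply hR hΥ n hE]
  refine tsum_congr fun g => (lintegral_prod (fun p : B × B =>
    E.indicator 1 (R g⁻¹ p.2 - R g⁻¹ p.1) * (Υ n g p.1 p.2 : ℝ≥0∞))
    (Measurable.aemeasurable ?_)).symm
  have h1 := hR.measurable g⁻¹
  have hi : Measurable (E.indicator (1 : ℝ → ℝ≥0∞)) := measurable_one.indicator hE
  exact (hi.comp (by fun_prop : Measurable fun p : B × B => R g⁻¹ p.2 - R g⁻¹ p.1)).mul
    (hΥ.measurable_coe n g)

omit [MetricSpace B] [CompactSpace B] [BorelSpace B] [StandardBorelSpace X] in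
theorem exists_measure_compl_boundedSaturation_le (hν : IsNonsingular Γ ν)
    (hR : IsLogRNCocycle ν R) (hμ : IsMeasurePreserving Γ μ) (hA : MeasurableSet A)
    (hsat : ∀ᵐ p ∂(ν.prod μ), ∃ g : Γ, g • p ∈ A) {ε : ℝ≥0∞} (hε : 0 < ε) :
    ∃ M : ℕ, (ν.prod μ) (boundedSaturation R A M)ᶜ ≤ ε := by
  have hm := fun g => ((hν.prod hμ.isNonsingular) g).measurable
  have ht := tendsto_measure_iInter_atTop (μ := ν.prod μ)
    (s := fun M : ℕ => (boundedSaturation R A (M : ℝ))ᶜ)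
    (fun M => (measurableSet_boundedSaturation hR hm hA M).compl.nullMeasurableSet)
    (fun M N hMN p hp ⟨g, h1, h2⟩ => hp ⟨g, h1, h2.trans (by exact_mod_cast hMN)⟩)
    ⟨0, measure_ne_top _ _⟩
  have h0 : (ν.prod μ) (⋂ M : ℕ, (boundedSaturation R A (M : ℝ))ᶜ) = 0 := by
    refine measure_mono_null ?_ (ae_iff.1 hsat)
    rintro p hp ⟨g, hg⟩
    obtain ⟨M, hM⟩ := exists_nat_ge |R g p.1|
    exact Set.mem_iInter.1 hp M ⟨g, hg, hM⟩
  rw [h0] at ht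
  exact (ENNReal.tendsto_nhds_zero.1 ht ε hε).exists

/-- If the return cocycle of a set with conull saturation stays away from `T`, then the measures
`ζ_n` of a neighbourhood of `T` tend to zero. -/
theorem tendsto_zeta_ball (hν : IsNonsingular Γ ν) (hR : IsLogRNCocycle ν R)
    (hΥ : IsAdmissibleFamily ν R Υ) (hμ : IsMeasurePreserving Γ μ) (hA : MeasurableSet A)
    (hsat : ∀ᵐ p ∂(ν.prod μ), ∃ g : Γ, g • p ∈ A) {η T : ℝ} (hη0 : 0 < η) (hη : η ≤ 1)
    (hsep : ∀ p ∈ A, ∀ g : Γ, g • p ∈ A → 2 * η ≤ |R g p.1 - T|) :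
    Tendsto (fun n => zeta ν R Υ n (Metric.ball T η)) atTop (𝓝 0) := by
  rw [ENNReal.tendsto_nhds_zero]
  intro ε hε
  have hε2 : 0 < ε / 2 := ENNReal.half_pos hε.ne'
  have hm := fun g => ((hν.prod hμ.isNonsingular) g).measurable
  obtain ⟨M, hM⟩ := exists_measure_compl_boundedSaturation_le hν hR hμ hA hsat hε2
  obtain ⟨C, hC0, hC⟩ := hΥ.cocycle_bound
  set W := maharamSaturation R A η with hWdef
  have hW : MeasurableSet W := measurableSet_maharamSaturation hR hm hA η
  have hG := measurableSet_boundedSaturation hR hm hA M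
  set G := boundedSaturation R A (M : ℝ) with hGdef
  set l := μ.prod ((volume : Measure ℝ).restrict (Set.Icc (-(M + 1 + C)) (M + 1 + C))) with hl
  have hη0' : ENNReal.ofReal η ≠ 0 := by simpa using hη0
  filter_upwards [ENNReal.tendsto_nhds_zero.1
    (hΥ.tendsto_lintegral_symmDiff_section hν l hW) (ENNReal.ofReal η * (ε / 2))
    (ENNReal.mul_pos hη0' hε2.ne')] with n hn
  -- The proportion of `X` over `b` without a bounded return; it contributes at most half of the
  -- allowed error.
  set w : B → ℝ≥0∞ := fun b => μ (Prod.mk b ⁻¹' Gᶜ) with hw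
  have hwm : Measurable w := measurable_measure_prodMk_left hG.compl
  have hwint : ∫⁻ b, w b ∂ν ≤ ε / 2 := by rwa [hw, ← Measure.prod_apply hG.compl]
  have hmain : ENNReal.ofReal η * zeta ν R Υ n (Metric.ball T η) ≤
      ENNReal.ofReal η * (ε / 2) + ENNReal.ofReal η * (ε / 2) := by
    rw [zeta_apply_prod hR hΥ n Metric.isOpen_ball.measurableSet, ← ENNReal.tsum_mul_left]
    have hmw : ∀ g, Measurable fun p : B × B =>
        ENNReal.ofReal η * w p.1 * (Υ n g p.1 p.2 : ℝ≥0∞) := fun g =>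
      ((hwm.comp measurable_fst).const_mul _).mul (hΥ.measurable_coe n g)
    calc _ ≤ ∑' g, ∫⁻ p : B × B, ((l (symmDiff (Prod.mk p.1 ⁻¹' W) (Prod.mk p.2 ⁻¹' W)) +
        l (symmDiff (Prod.mk (g⁻¹ • p.1) ⁻¹' W) (Prod.mk (g⁻¹ • p.2) ⁻¹' W))) *
        (Υ n g p.1 p.2 : ℝ≥0∞) + ENNReal.ofReal η * w p.1 * (Υ n g p.1 p.2 : ℝ≥0∞))
          ∂(ν.prod ν) := by
          refine ENNReal.tsum_le_tsum fun g => ?_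
          rw [← lintegral_const_mul' _ _ ENNReal.ofReal_ne_top]
          refine lintegral_mono_ae ?_
          filter_upwards [hC n g] with p hp
          rw [← add_mul, ← mul_assoc]
          rcases eq_or_ne (Υ n g p.1 p.2) 0 with h0 | h0
          · simp [h0]
          refine mul_le_mul_left ?_ _
          by_cases hτ : R g⁻¹ p.2 - R g⁻¹ p.1 ∈ Metric.ball T η
          swap
          · simp [hτ]
          rw [Set.indicator_of_mem hτ, Pi.one_apply, mul_one]
          rw [Metric.mem_ball, Real.dist_eq] at hτ
          have hb := measure_translate_maharamSaturation_le hR hm hA η hμ g⁻¹ (K := M + 1)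
            (hp (pos_iff_ne_zero.2 h0))
          refine le_trans ?_ (add_le_add_left hb _)
          have hEm : MeasurableSet {q : X × ℝ | q.2 ∈ Set.Icc (-((M : ℝ) + 1)) (M + 1) ∧
              ¬ ((p.1, q) ∈ W ↔ (p.1, (q.1, q.2 - (R g⁻¹ p.2 - R g⁻¹ p.1))) ∈ W)} := by
            have i1 : MeasurableSet {q : X × ℝ | (p.1, q) ∈ W} := measurable_prodMk_left hW
            have i2 : MeasurableSet
                {q : X × ℝ | (p.1, (q.1, q.2 - (R g⁻¹ p.2 - R g⁻¹ p.1))) ∈ W} :=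
              (by fun_prop : Measurable fun q : X × ℝ =>
                (p.1, (q.1, q.2 - (R g⁻¹ p.2 - R g⁻¹ p.1)))) hW
            exact (measurable_snd measurableSet_Icc).inter (i1.iff i2).compl
          rw [Measure.prod_apply hEm]
          have hGs : MeasurableSet (Prod.mk p.1 ⁻¹' G) := measurable_prodMk_left hG
          -- By Fubini, each `x` in the section of `G` contributes at least `η` to the measure of
          -- the moved set; the remaining `x` are charged to `w`.
          calc ENNReal.ofReal η = ENNReal.ofReal η * μ (Prod.mk p.1 ⁻¹' G) +
                ENNReal.ofReal η * w p.1 := by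
                have h1 : μ (Prod.mk p.1 ⁻¹' G) + w p.1 = 1 :=
                  (measure_add_measure_compl hGs).trans measure_univ
                rw [← mul_add, h1, mul_one]
            _ ≤ _ := by
                refine add_le_add_left ?_ _
                rw [← setLIntegral_const, ← lintegral_indicator hGs]
                refine lintegral_mono fun x => ?_
                refine Set.indicator_apply_le' (fun hx => ?_) fun _ => zero_le
                exact le_volume_translate_maharamSaturation hR hη hsep hx hτ
      _ = _ := by
          simp_rw [lintegral_add_right _ (hmw _)]
          exact ENNReal.tsum_add
      _ ≤ _ := by
          refine add_le_add hn ?_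
          rw [hΥ.tsum_lintegral_fst n (hwm.const_mul _), lintegral_const_mul _ hwm]
          gcongr
  rw [← mul_add, ENNReal.add_halves] at hmain
  exact (ENNReal.mul_le_mul_iff_right hη0' ENNReal.ofReal_ne_top).1 hmain

/-- If `T` is in the support of a limit point of the measures `ζ_n`, then every set with conull
saturation has returns at which the cocycle is close to `T`. -/
theorem exists_return_near (hν : IsNonsingular Γ ν) (hR : IsLogRNCocycle ν R)
    (hΥ : IsAdmissibleFamily ν R Υ) {ζ : ProbabilityMeasure ℝ}
    (hζ : MapClusterPt ζ atTop (zetaProb hR hΥ)) {T : ℝ} (hTζ : T ∈ (ζ : Measure ℝ).support)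
    (hμ : IsMeasurePreserving Γ μ) (hA : MeasurableSet A)
    (hsat : ∀ᵐ p ∂(ν.prod μ), ∃ g : Γ, g • p ∈ A) {δ : ℝ} (hδ : 0 < δ) :
    ∃ g : Γ, 0 < (ν.prod μ) {p | p ∈ A ∧ g • p ∈ A ∧ |R g p.1 - T| < δ} := by
  by_contra! hcon
  have hns := hν.prod hμ.isNonsingular
  set N : Set (B × X) := ⋃ g : Γ, {p | p ∈ A ∧ g • p ∈ A ∧ |R g p.1 - T| < δ} with hN
  have hN0 : (ν.prod μ) N = 0 := measure_iUnion_null fun g => le_zero_iff.1 (hcon g)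
  have hNm : MeasurableSet N := by
    refine MeasurableSet.iUnion fun g => hA.inter (((hns g).measurable hA).inter ?_)
    have := hR.measurable g
    exact measurableSet_lt (by fun_prop : Measurable fun p : B × X => |R g p.1 - T|)
      measurable_const
  -- Removing the null set `N` of unwanted returns keeps the saturation conull, since the preimages
  -- of `N` under the countable group are null.
  have hsat' : ∀ᵐ p ∂(ν.prod μ), ∃ g : Γ, g • p ∈ A \ N := by
    have h1 : ∀ᵐ p ∂(ν.prod μ), ∀ g : Γ, g • p ∉ N := ae_all_iff.2 fun g =>
      (hns g).ae (measure_eq_zero_iff_ae_notMem.1 hN0)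
    filter_upwards [hsat, h1] with p ⟨g, hg⟩ hp
    exact ⟨g, hg, hp g⟩
  set η := min (δ / 2) 1 with hη
  have hη0 : 0 < η := lt_min (by positivity) one_pos
  have hlim := tendsto_zeta_ball (T := T) hν hR hΥ hμ (hA.diff hNm) hsat' hη0 (min_le_right _ _)
    (fun p hp g hg => by
      by_contra! hlt
      refine hp.2 (Set.mem_iUnion.2 ⟨g, hp.1, hg.1, hlt.trans_le ?_⟩)
      linarith [min_le_left (δ / 2) 1])
  -- Along an ultrafilter the cluster point is a limit, and the portmanteau inequality for open sets
  -- gives the ball zero mass.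
  obtain ⟨U, hU, hUlim⟩ := mapClusterPt_iff_ultrafilter.1 hζ
  have h1 := ProbabilityMeasure.le_liminf_measure_open_of_tendsto hUlim
    (Metric.isOpen_ball (x := T) (ε := η))
  have h2 : Tendsto (fun n => (zetaProb hR hΥ n : Measure ℝ) (Metric.ball T η)) U (𝓝 0) :=
    hlim.mono_left hU
  rw [h2.liminf_eq] at h1
  exact (Measure.mem_support_iff_forall T).1 hTζ _ (Metric.ball_mem_nhds T hη0) |>.not_ge h1

end Return

/-! ### Ergodic decomposition of measure-preserving actions. -/

section ErgodicDecomposition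

open ProbabilityTheory

/-- The σ-algebra of invariant measurable sets. -/
@[reducible]
def invariantSets (Γ X : Type*) [Group Γ] [MulAction Γ X] [MeasurableSpace X] :
    MeasurableSpace X :=
  ⨅ g : Γ, MeasurableSpace.invariants fun x : X => g • x

section

variable {Γ X : Type*} [Group Γ] [MulAction Γ X] [MeasurableSpace X]

theorem measurableSet_invariantSets {s : Set X} : MeasurableSet[invariantSets Γ X] s ↔
    MeasurableSet s ∧ ∀ g : Γ, (fun x => g • x) ⁻¹' s = s := by
  rw [invariantSets, MeasurableSpace.measurableSet_iInf]
  simp only [MeasurableSpace.measurableSet_invariants]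
  exact ⟨fun h => ⟨(h 1).1, fun g => (h g).2⟩, fun h g => ⟨h.1, h.2 g⟩⟩

theorem invariantSets_le : invariantSets Γ X ≤ ‹MeasurableSpace X› := fun _ hs =>
  (measurableSet_invariantSets.1 hs).1

variable {μ : Measure X} [IsProbabilityMeasure μ]

omit [IsProbabilityMeasure μ] in
/-- A function that is almost everywhere fixed by the action has an invariant representative. -/
theorem exists_invariant_representative [Countable Γ] (hμ : IsMeasurePreserving Γ μ) {p : X → ℝ}
    (hp : Measurable p) (hinv : ∀ g : Γ, ∀ᵐ x ∂μ, p (g • x) = p x) :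
    ∃ q : X → ℝ, Measurable[invariantSets Γ X] q ∧ p =ᵐ[μ] q := by
  classical
  -- The set on which `p` is constant along orbits is itself invariant and conull, so cutting `p`
  -- off outside it gives the representative.
  set N : Set X := {x | ∀ g : Γ, p (g • x) = p x} with hN
  have hNm : MeasurableSet N := by
    have e : N = ⋂ g : Γ, {x | p (g • x) = p x} := by ext; simp [hN]
    rw [e]
    exact MeasurableSet.iInter fun g => measurableSet_eq_fun (hp.comp (hμ g).measurable) hp
  have hNinv : ∀ (g : Γ) (x : X), g • x ∈ N ↔ x ∈ N := by
    have h1 : ∀ (g : Γ) (x : X), x ∈ N → g • x ∈ N := fun g x hx h => by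
      rw [← mul_smul, hx, hx]
    exact fun g x => ⟨fun h => by simpa using h1 g⁻¹ _ h, h1 g x⟩
  refine ⟨N.indicator p, fun t ht => measurableSet_invariantSets.2
    ⟨(hp.indicator hNm) ht, fun g => ?_⟩, ?_⟩
  · ext x
    simp only [Set.mem_preimage]
    by_cases hx : x ∈ N
    · rw [Set.indicator_of_mem hx, Set.indicator_of_mem ((hNinv g x).2 hx), hx g]
    · rw [Set.indicator_of_notMem hx, Set.indicator_of_notMem fun h => hx ((hNinv g x).1 h)]
  · filter_upwards [ae_all_iff.2 hinv] with x hx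
    rw [Set.indicator_of_mem (show x ∈ N from hx)]

/-- `φ` has the same integral as the indicator function of `s` over every invariant set, for every
invariant probability measure. -/
structure IsIntegralEquivalent (Γ : Type*) [Group Γ] [MulAction Γ X] (s : Set X) (φ : X → ℝ) :
    Prop where
  measurable : Measurable φ
  bounded : ∃ c, ∀ x, |φ x| ≤ c
  setIntegral_eq : ∀ (m : Measure X) [IsProbabilityMeasure m], IsMeasurePreserving Γ m →
    ∀ S, MeasurableSet[invariantSets Γ X] S → ∫ x in S, φ x ∂m = m.real (S ∩ s)

theorem IsIntegralEquivalent.integrable {s : Set X} {φ : X → ℝ}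
    (h : IsIntegralEquivalent Γ s φ) (m : Measure X) [IsFiniteMeasure m] : Integrable φ m :=
  h.bounded.elim fun c hc =>
    Integrable.of_bound h.measurable.aestronglyMeasurable c (Eventually.of_forall hc)

theorem IsIntegralEquivalent.indicator {s : Set X} (hs : MeasurableSet s) :
    IsIntegralEquivalent Γ s (s.indicator fun _ => (1 : ℝ)) where
  measurable := measurable_const.indicator hs
  bounded := ⟨1, fun x => by by_cases h : x ∈ s <;> simp [h]⟩
  setIntegral_eq m _ _ S _ := by
    rw [setIntegral_indicator hs]
    simp

theorem IsIntegralEquivalent.comp_smul {s : Set X} {φ : X → ℝ}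
    (h : IsIntegralEquivalent Γ s φ) (g : Γ) (hg : Measurable fun x : X => g • x) :
    IsIntegralEquivalent Γ s fun x => φ (g • x) where
  measurable := h.measurable.comp hg
  bounded := h.bounded.imp fun c hc x => hc _
  setIntegral_eq m _ hm S hS := by
    obtain ⟨hS1, hS2⟩ := measurableSet_invariantSets.1 hS
    rw [← h.setIntegral_eq m hm S hS]
    conv_rhs => rw [← (hm g).map_eq, setIntegral_map hS1
      h.measurable.aestronglyMeasurable hg.aemeasurable, hS2]

theorem IsIntegralEquivalent.convex_combination {s : Set X} {φ ψ : X → ℝ}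
    (hφ : IsIntegralEquivalent Γ s φ) (hψ : IsIntegralEquivalent Γ s ψ) {a b : ℝ}
    (hab : a + b = 1) : IsIntegralEquivalent Γ s fun x => a * φ x + b * ψ x where
  measurable := (hφ.measurable.const_mul a).add (hψ.measurable.const_mul b)
  bounded := by
    obtain ⟨c, hc⟩ := hφ.bounded
    obtain ⟨d, hd⟩ := hψ.bounded
    refine ⟨|a| * c + |b| * d, fun x => (abs_add_le _ _).trans ?_⟩
    rw [abs_mul, abs_mul]
    gcongr
    exacts [hc x, hd x]
  setIntegral_eq m _ hm S hS := by
    rw [integral_add ((hφ.integrable _).const_mul a) ((hψ.integrable _).const_mul b),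
      integral_const_mul, integral_const_mul, hφ.setIntegral_eq m hm S hS,
      hψ.setIntegral_eq m hm S hS, ← add_mul, hab, one_mul]

/-- A mean ergodic theorem: the minimal element of the closed convex hull of the translates of an
indicator function is invariant. -/
theorem exists_invariant_approximation [Countable Γ] (hμ : IsMeasurePreserving Γ μ) {s : Set X}
    (hs : MeasurableSet s) : ∃ (p : X → ℝ) (φ : ℕ → X → ℝ), Measurable[invariantSets Γ X] p ∧
      (∀ k, IsIntegralEquivalent Γ s (φ k)) ∧
      Tendsto (fun k => ∫⁻ x, ‖φ k x - p x‖ₑ ∂μ) atTop (𝓝 0) := by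
  have : MeasurableConstSMul Γ X := ⟨fun g => (hμ g).measurable⟩
  have : SMulInvariantMeasure Γ X μ := ⟨fun g t ht => (hμ g).measure_preimage ht.nullMeasurableSet⟩
  set 𝒦 : Set (Lp ℝ 2 μ) := {u | ∃ φ : X → ℝ, IsIntegralEquivalent Γ s φ ∧ u =ᵐ[μ] φ} with h𝒦
  have hmem : ∀ {φ : X → ℝ}, IsIntegralEquivalent Γ s φ → MemLp φ 2 μ := fun {φ} h =>
    h.bounded.elim fun c hc =>
      MemLp.of_bound h.measurable.aestronglyMeasurable c (Eventually.of_forall hc)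
  have hne : 𝒦.Nonempty := ⟨(hmem (IsIntegralEquivalent.indicator (Γ := Γ) hs)).toLp _, _,
    IsIntegralEquivalent.indicator hs, MemLp.coeFn_toLp _⟩
  have hconv : Convex ℝ 𝒦 := by
    rintro u ⟨φ, hφ, hu⟩ v ⟨ψ, hψ, hv⟩ a b - - hab
    refine ⟨_, hφ.convex_combination hψ hab, ?_⟩
    filter_upwards [hu, hv, Lp.coeFn_add (a • u) (b • v), Lp.coeFn_smul a u, Lp.coeFn_smul b v]
      with x h1 h2 h3 h4 h5
    rw [h3, Pi.add_apply, h4, h5, Pi.smul_apply, Pi.smul_apply, h1, h2, smul_eq_mul, smul_eq_mul]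
  have hsm : ∀ (g : Γ), ∀ u ∈ 𝒦, DomMulAct.mk g • u ∈ 𝒦 := by
    rintro g u ⟨φ, hφ, hu⟩
    refine ⟨_, hφ.comp_smul g (hμ g).measurable, ?_⟩
    refine (DomMulAct.smul_Lp_ae_eq (DomMulAct.mk g) u).trans ?_
    exact (hμ g).quasiMeasurePreserving.ae hu
  have hconv' := hconv.closure
  obtain ⟨P, hPK, hP⟩ := exists_norm_eq_iInf_of_complete_convex hne.closure
    isClosed_closure.isComplete hconv' 0
  have hPinv : ∀ g : Γ, DomMulAct.mk g • P = P := by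
    intro g
    have hQK : DomMulAct.mk g • P ∈ closure 𝒦 :=
      map_mem_closure (continuous_const_smul (DomMulAct.mk g)) hPK (hsm g)
    have hQ : ‖0 - DomMulAct.mk g • P‖ = ⨅ w : closure 𝒦, ‖0 - (w : Lp ℝ 2 μ)‖ := by
      rw [← hP, zero_sub, zero_sub, norm_neg, norm_neg, DomMulAct.norm_smul_Lp]
    set Q := DomMulAct.mk g • P with hQdef
    -- Both `P` and its translate `Q` minimize the norm; their variational inequalities add up to
    -- `‖Q - P‖² ≤ 0`.
    have h1 := (norm_eq_iInf_iff_real_inner_le_zero hconv' hPK).1 hP Q hQK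
    have h2 := (norm_eq_iInf_iff_real_inner_le_zero hconv' hQK).1 hQ P hPK
    have h3 : inner ℝ (Q - P) (Q - P) ≤ 0 := by
      simp only [inner_sub_left, inner_sub_right, inner_zero_left] at h1 h2 ⊢
      linarith
    rw [real_inner_self_eq_norm_sq] at h3
    exact sub_eq_zero.1 (norm_eq_zero.1 (pow_eq_zero_iff two_ne_zero |>.1 (h3.antisymm (sq_nonneg _))))
  obtain ⟨u, hu𝒦, hu⟩ := mem_closure_iff_seq_limit.1 hPK
  choose φ hφ huφ using hu𝒦
  obtain ⟨p, hp, hPp⟩ := exists_invariant_representative hμ (Lp.stronglyMeasurable P).measurable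
    (fun g => by
      have h1 := DomMulAct.smul_Lp_ae_eq (DomMulAct.mk g) P
      rw [hPinv g] at h1
      filter_upwards [h1] with x hx
      exact hx.symm)
  refine ⟨p, φ, hp, hφ, ?_⟩
  have hlim : Tendsto (fun k => ‖u k - P‖ₑ) atTop (𝓝 0) := by
    have h1 := (tendsto_iff_edist_tendsto_0.1 hu)
    simpa only [edist_eq_enorm_sub] using h1
  refine tendsto_of_tendsto_of_tendsto_of_le_of_le tendsto_const_nhds hlim (fun _ => zero_le)
    fun k => ?_
  calc ∫⁻ x, ‖φ k x - p x‖ₑ ∂μ = eLpNorm (u k - P : Lp ℝ 2 μ) 1 μ := by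
        rw [eLpNorm_one_eq_lintegral_enorm]
        refine lintegral_congr_ae ?_
        filter_upwards [huφ k, hPp, Lp.coeFn_sub (u k) P] with x h1 h2 h3
        rw [h3, Pi.sub_apply, h1, h2]
    _ ≤ eLpNorm (u k - P : Lp ℝ 2 μ) 2 μ :=
        eLpNorm_le_eLpNorm_of_exponent_le (by norm_num) (Lp.aestronglyMeasurable _)
    _ = ‖u k - P‖ₑ := (Lp.enorm_def _).symm

/-- An invariant probability measure is ergodic as soon as, for all sets of a generating
`π`-system, suitable averages of the indicator functions converge to constants. -/
theorem isErgodic_of_forall_approximation {m : Measure X} [IsProbabilityMeasure m]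
    (hm : IsMeasurePreserving Γ m) {𝒞 : Set (Set X)}
    (hgen : ‹MeasurableSpace X› = MeasurableSpace.generateFrom 𝒞) (hpi : IsPiSystem 𝒞)
    (happ : ∀ s ∈ 𝒞, ∃ (c : ℝ) (φ : ℕ → X → ℝ), (∀ k, IsIntegralEquivalent Γ s (φ k)) ∧
      liminf (fun k => ∫⁻ x, ‖φ k x - c‖ₑ ∂m) atTop = 0) : IsErgodic Γ m := by
  intro S hS hSinv
  have hSI : MeasurableSet[invariantSets Γ X] S := measurableSet_invariantSets.2 ⟨hS, hSinv⟩
  have key : ∀ s ∈ 𝒞, m (S ∩ s) = m S * m s := by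
    intro s hs
    obtain ⟨c, φ, hφ, hlim⟩ := happ s hs
    -- Taking `S` to be everything identifies `c` as the measure of `s`, so invariant sets are
    -- independent of `𝒞`, hence of themselves.
    have h1 : ∀ S, MeasurableSet[invariantSets Γ X] S → m.real (S ∩ s) = c * m.real S := by
      intro S hSI
      have h2 : ‖m.real (S ∩ s) - c * m.real S‖ₑ ≤
          liminf (fun k => ∫⁻ x, ‖φ k x - c‖ₑ ∂m) atTop := by
        refine le_liminf_of_le ?_ (Eventually.of_forall fun k => ?_)
        · exact isCobounded_ge_of_top
        have h3 : m.real (S ∩ s) - c * m.real S = ∫ x in S, (φ k x - c) ∂m := by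
          rw [integral_sub ((hφ k).integrable _) (integrable_const c),
            (hφ k).setIntegral_eq m hm S hSI]
          simp [mul_comm]
        rw [h3]
        exact (enorm_integral_le_lintegral_enorm _).trans (setLIntegral_le_lintegral _ _)
      rw [hlim, nonpos_iff_eq_zero, enorm_eq_zero, sub_eq_zero] at h2
      exact h2
    have h4 := h1 Set.univ MeasurableSet.univ
    simp only [Set.univ_inter, probReal_univ, mul_one] at h4
    have h5 := h1 S hSI
    rw [← h4, mul_comm] at h5
    rw [← ENNReal.toReal_eq_toReal_iff' (by finiteness) (by finiteness), ENNReal.toReal_mul]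
    exact h5
  have hext : m.restrict S = m S • m := by
    refine ext_of_generate_finite 𝒞 hgen hpi (fun s hs => ?_) (by simp)
    have hsm : MeasurableSet s := hgen ▸ MeasurableSpace.measurableSet_generateFrom hs
    rw [Measure.restrict_apply hsm, Set.inter_comm, key s hs]
    simp
  have h6 : m S = m S * m S := by
    conv_lhs => rw [← Measure.restrict_apply_self, hext]
    simp
  rcases eq_or_ne (m S) 0 with h | h
  · exact Or.inl h
  · refine Or.inr ((prob_compl_eq_zero_iff hS).2 ?_)
    have h7 : m S * 1 = m S * m S := by rwa [mul_one]
    exact ((ENNReal.mul_right_inj h (measure_ne_top _ _)).1 h7).symm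

end

theorem ae_map_of_forall {α β : Type*} {mα : MeasurableSpace α} {mβ : MeasurableSpace β}
    {m : Measure α} {f : α → β} (hf : Measurable f) {q : β → Prop} (hq : MeasurableSet {y | q y})
    (h : ∀ x, q (f x)) : ∀ᵐ y ∂(m.map f), q y :=
  (ae_map_iff hf.aemeasurable hq).2 (Eventually.of_forall h)

variable {Γ X : Type*} [Group Γ] [Countable Γ] [MulAction Γ X] [MeasurableSpace X]
  [StandardBorelSpace X] {μ : Measure X} [IsProbabilityMeasure μ]

omit [Countable Γ] in
theorem lintegral_lintegral_condExpKernel {f : X → ℝ≥0∞} (hf : Measurable f) :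
    ∫⁻ ω, ∫⁻ x, f x ∂(condExpKernel μ (invariantSets Γ X) ω) ∂μ = ∫⁻ x, f x ∂μ := by
  have hle := invariantSets_le (Γ := Γ) (X := X)
  have hm : Measurable[invariantSets Γ X] fun ω =>
      ∫⁻ x, f x ∂(condExpKernel μ (invariantSets Γ X) ω) := hf.lintegral_kernel
  conv_rhs => rw [← condExpKernel_comp_trim (μ := μ) hle,
    Measure.lintegral_bind (Kernel.aemeasurable _) hf.aemeasurable]
  exact (lintegral_trim hle hm).symm

-- The joint law of `ω` and a point drawn from its conditional measure is the image of `μ` on the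
-- diagonal, where the equality is trivial.
omit [Countable Γ] in
theorem ae_condExpKernel_ae_eq {p : X → ℝ} (hp : Measurable[invariantSets Γ X] p) :
    ∀ᵐ ω ∂μ, ∀ᵐ x ∂(condExpKernel μ (invariantSets Γ X) ω), p x = p ω := by
  have hle := invariantSets_le (Γ := Γ) (X := X)
  refine ae_of_ae_trim hle (Measure.ae_ae_of_ae_compProd (p := fun q : X × X => p q.2 = p q.1) ?_)
  rw [compProd_trim_condExpKernel hle]
  have h1 : @Measurable (X × X) ℝ ((invariantSets Γ X).prod inferInstance) _ fun q => p q.1 :=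
    hp.comp (@measurable_fst X X (invariantSets Γ X) _)
  have h2 : @Measurable (X × X) ℝ ((invariantSets Γ X).prod inferInstance) _ fun q => p q.2 :=
    (hp.mono hle le_rfl).comp (@measurable_snd X X (invariantSets Γ X) _)
  have hd : @Measurable X (X × X) _ ((invariantSets Γ X).prod inferInstance) Function.diag :=
    (measurable_id'' hle).prodMk measurable_id
  have hset : @MeasurableSet (X × X) ((invariantSets Γ X).prod inferInstance)
      {q | p q.2 = p q.1} := by
    have h3 := (h2.sub h1) (measurableSet_singleton 0)
    convert! h3 using 1
    ext q
    simp [sub_eq_zero]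
  exact ae_map_of_forall hd hset fun _ => rfl

/-- A set and its translate meet every invariant set in equal mass, so their conditional
probabilities agree almost everywhere. A countable generating algebra allows one null set for all of
them. -/
theorem ae_isMeasurePreserving_condExpKernel (hμ : IsMeasurePreserving Γ μ) :
    ∀ᵐ ω ∂μ, IsMeasurePreserving Γ (condExpKernel μ (invariantSets Γ X) ω) := by
  have hle := invariantSets_le (Γ := Γ) (X := X)
  set 𝒞 := generateSetAlgebra (MeasurableSpace.countableGeneratingSet X) with h𝒞
  have h𝒞c : 𝒞.Countable :=
    countable_generateSetAlgebra (MeasurableSpace.countable_countableGeneratingSet)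
  have hgen : ‹MeasurableSpace X› = MeasurableSpace.generateFrom 𝒞 := by
    rw [generateFrom_generateSetAlgebra_eq, MeasurableSpace.generateFrom_countableGeneratingSet]
  have h𝒞m : ∀ s ∈ 𝒞, MeasurableSet s := fun s hs =>
    hgen ▸ MeasurableSpace.measurableSet_generateFrom hs
  have hcond : ∀ g : Γ, ∀ s, MeasurableSet s →
      μ⟦s | invariantSets Γ X⟧ =ᵐ[μ] μ⟦(fun x => g • x) ⁻¹' s | invariantSets Γ X⟧ := by
    intro g s hs
    have hgs := (hμ g).measurable hs
    refine ae_eq_condExp_of_forall_setIntegral_eq hle ((integrable_const 1).indicator hgs)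
      (fun S _ _ => integrable_condExp.integrableOn) (fun S hS _ => ?_)
      stronglyMeasurable_condExp.aestronglyMeasurable
    obtain ⟨hS1, hS2⟩ := measurableSet_invariantSets.1 hS
    rw [setIntegral_condExp hle ((integrable_const 1).indicator hs) hS, setIntegral_indicator hs,
      setIntegral_indicator hgs]
    simp only [integral_const, smul_eq_mul, mul_one, measureReal_restrict_apply_univ]
    rw [measureReal_def, measureReal_def,
      ← (hμ g).measure_preimage (hS1.inter hs).nullMeasurableSet, Set.preimage_inter, hS2 g]
  have hall : ∀ᵐ ω ∂μ, ∀ g : Γ, ∀ s ∈ 𝒞, condExpKernel μ (invariantSets Γ X) ω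
      ((fun x => g • x) ⁻¹' s) = condExpKernel μ (invariantSets Γ X) ω s := by
    refine ae_all_iff.2 fun g => (ae_ball_iff h𝒞c).2 fun s hs => ?_
    have hsm := h𝒞m s hs
    filter_upwards [hcond g s hsm, condExpKernel_ae_eq_condExp hle hsm (μ := μ),
      condExpKernel_ae_eq_condExp hle ((hμ g).measurable hsm) (μ := μ)] with ω h1 h2 h3
    rw [← measureReal_eq_measureReal_iff, h2, h3, h1]
  filter_upwards [hall] with ω hω g
  refine ⟨(hμ g).measurable, ?_⟩
  have : IsProbabilityMeasure ((condExpKernel μ (invariantSets Γ X) ω).map fun x => g • x) :=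
    Measure.isProbabilityMeasure_map (hμ g).measurable.aemeasurable
  refine ext_of_generate_finite 𝒞 hgen
    (fun s hs t ht _ => isSetAlgebra_generateSetAlgebra.inter_mem hs ht) (fun s hs => ?_) (by simp)
  rw [Measure.map_apply (hμ g).measurable (h𝒞m s hs), hω g s hs]

/-- Ergodic decomposition: almost every conditional measure given the invariant sets is ergodic. -/
theorem ae_isErgodic_condExpKernel (hμ : IsMeasurePreserving Γ μ) :
    ∀ᵐ ω ∂μ, IsErgodic Γ (condExpKernel μ (invariantSets Γ X) ω) := by
  have hle := invariantSets_le (Γ := Γ) (X := X)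
  set 𝒞 := generateSetAlgebra (MeasurableSpace.countableGeneratingSet X) with h𝒞
  have h𝒞c : 𝒞.Countable :=
    countable_generateSetAlgebra (MeasurableSpace.countable_countableGeneratingSet)
  have hgen : ‹MeasurableSpace X› = MeasurableSpace.generateFrom 𝒞 := by
    rw [generateFrom_generateSetAlgebra_eq, MeasurableSpace.generateFrom_countableGeneratingSet]
  have h𝒞m : ∀ s ∈ 𝒞, MeasurableSet s := fun s hs =>
    hgen ▸ MeasurableSpace.measurableSet_generateFrom hs
  have happ : ∀ᵐ ω ∂μ, ∀ s ∈ 𝒞, ∃ (c : ℝ) (φ : ℕ → X → ℝ),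
      (∀ k, IsIntegralEquivalent Γ s (φ k)) ∧
      liminf (fun k => ∫⁻ x, ‖φ k x - c‖ₑ ∂(condExpKernel μ (invariantSets Γ X) ω)) atTop = 0 := by
    refine (ae_ball_iff h𝒞c).2 fun s hs => ?_
    -- `IsIntegralEquivalent` does not refer to `μ`, so the same `φ k` serve the conditional
    -- measures. Fatou's lemma turns `L¹` convergence for `μ` into a vanishing liminf for almost
    -- every one of them, and `p` is almost surely constant there.
    obtain ⟨p, φ, hp, hφ, hlim⟩ := exists_invariant_approximation hμ (h𝒞m s hs)
    have hfm : ∀ k, Measurable fun x => ‖φ k x - p x‖ₑ := fun k =>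
      ((hφ k).measurable.sub (hp.mono hle le_rfl)).enorm
    have hkm : ∀ k, Measurable fun ω =>
        ∫⁻ x, ‖φ k x - p x‖ₑ ∂(condExpKernel μ (invariantSets Γ X) ω) := fun k =>
      (hfm k).lintegral_kernel.mono hle le_rfl
    have h0 : ∫⁻ ω, liminf (fun k =>
        ∫⁻ x, ‖φ k x - p x‖ₑ ∂(condExpKernel μ (invariantSets Γ X) ω)) atTop ∂μ = 0 := by
      refine le_zero_iff.1 ((lintegral_liminf_le hkm).trans_eq ?_)
      simp_rw [lintegral_lintegral_condExpKernel (hfm _)]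
      exact hlim.liminf_eq
    rw [lintegral_eq_zero_iff (Measurable.liminf hkm)] at h0
    filter_upwards [h0, ae_condExpKernel_ae_eq hp] with ω h1 h2
    refine ⟨p ω, φ, hφ, Eq.trans (congrArg (fun f => liminf f atTop) (funext fun k => ?_)) h1⟩
    refine lintegral_congr_ae ?_
    filter_upwards [h2] with x hx
    rw [hx]
  filter_upwards [happ, ae_isMeasurePreserving_condExpKernel hμ] with ω h1 h2
  exact isErgodic_of_forall_approximation h2 hgen
    (fun s hs t ht _ => isSetAlgebra_generateSetAlgebra.inter_mem hs ht) h1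

end ErgodicDecomposition

/-! ### From returns to ratio sets. -/

section RatioSet

open ProbabilityTheory

theorem IsErgodic.ae_exists_smul_mem {Γ Ω : Type*} [Group Γ] [Countable Γ] [MulAction Γ Ω]
    [MeasurableSpace Ω] {m : Measure Ω} (hm : IsErgodic Γ m)
    (hmeas : ∀ g : Γ, Measurable fun p : Ω => g • p) {A : Set Ω} (hA : MeasurableSet A)
    (hpos : 0 < m A) : ∀ᵐ p ∂m, ∃ g : Γ, g • p ∈ A := by
  set S : Set Ω := {p | ∃ g : Γ, g • p ∈ A} with hS
  have hSm : MeasurableSet S := by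
    have e : S = ⋃ g : Γ, (fun p => g • p) ⁻¹' A := by ext; simp [hS]
    rw [e]
    exact MeasurableSet.iUnion fun g => hmeas g hA
  rcases hm S hSm fun h => by
    ext p
    exact ⟨fun ⟨g, hg⟩ => ⟨g * h, by simpa [mul_smul] using hg⟩,
      fun ⟨g, hg⟩ => ⟨g * h⁻¹, by simpa [mul_smul] using hg⟩⟩ with h | h
  · exact absurd (measure_mono_null (show A ⊆ S from fun p hp => ⟨1, by simpa using hp⟩) h) hpos.ne'
  · exact h

theorem ofReal_exp_mem_ratioSet {Γ Ω : Type*} [Group Γ] [MulAction Γ Ω] [MeasurableSpace Ω]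
    {m : Measure Ω} {r : Γ → Ω → ℝ} (hr : ∀ g, Measurable (r g)) (hr1 : ∀ p, r 1 p = 0)
    (hmeas : ∀ g : Γ, Measurable fun p : Ω => g • p)
    (hrn : ∀ g, ∀ᵐ p ∂m, (rnDerivAction m g p).toReal = Real.exp (r g p)) {T : ℝ} (hT : T ≠ 0)
    (hret : ∀ A, MeasurableSet A → 0 < m A → ∀ δ : ℝ, 0 < δ →
      ∃ g : Γ, 0 < m {p | p ∈ A ∧ g • p ∈ A ∧ |r g p - T| < δ}) :
    ENNReal.ofReal (Real.exp T) ∈ ratioSet Γ m := by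
  refine fun A hA hpos => ⟨fun _ ε hε => ?_, fun h => absurd h ENNReal.ofReal_ne_top⟩
  rw [ENNReal.toReal_ofReal (Real.exp_pos T).le]
  obtain ⟨δ, hδ, hexp⟩ := Metric.continuousAt_iff.1 Real.continuous_exp.continuousAt ε hε
  -- The bound by `|T|` forces `g ≠ 1`, as the cocycle vanishes at the identity.
  obtain ⟨g, hg⟩ := hret A hA hpos (min δ |T|) (lt_min hδ (abs_pos.2 hT))
  set D := {p | p ∈ A ∧ g • p ∈ A ∧ |r g p - T| < min δ |T|} with hD
  have hDm : MeasurableSet D := by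
    have := hr g
    exact hA.inter ((hmeas g hA).inter
      (measurableSet_lt (by fun_prop : Measurable fun p => |r g p - T|) measurable_const))
  have hrnm : MeasurableSet {p | (rnDerivAction m g p).toReal = Real.exp (r g p)} :=
    measurableSet_eq_fun (Measure.measurable_rnDeriv _ _).ennreal_toReal
      (Real.measurable_exp.comp (hr g))
  refine ⟨D ∩ {p | (rnDerivAction m g p).toReal = Real.exp (r g p)}, fun p hp => hp.1.1,
    hDm.inter hrnm, ?_, g, ?_, fun p hp => hp.1.2.1, fun p hp => ?_⟩
  · rwa [measure_inter_conull (hrn g)]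
  · rintro rfl
    obtain ⟨p, -, -, hp⟩ := nonempty_of_measure_ne_zero hg.ne'
    rw [hr1, zero_sub, abs_neg] at hp
    exact (min_le_right _ _).not_gt hp
  · rw [hp.2, ← Real.dist_eq]
    exact hexp ((Real.dist_eq _ _).trans_lt (hp.1.2.2.trans_le (min_le_left _ _)))

theorem ofReal_exp_notMem {T : ℝ} (hT : T ≠ 0) :
    ENNReal.ofReal (Real.exp T) ∉ ({0, 1, ∞} : Set ℝ≥0∞) := by
  simp [Real.exp_pos, hT, ENNReal.ofReal_eq_one]

variable {Γ : Type*} [Group Γ] [Countable Γ] {B : Type*} [MetricSpace B] [CompactSpace B]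
  [MeasurableSpace B] [BorelSpace B] [MulAction Γ B] {ν : Measure B} [IsProbabilityMeasure ν]
  {R : Γ → B → ℝ} {Υ : ℕ → Γ → B → B → ℝ≥0}

theorem ofReal_exp_mem_ratioSet_of_isErgodic (hν : IsNonsingular Γ ν) (hR : IsLogRNCocycle ν R)
    (hΥ : IsAdmissibleFamily ν R Υ) {ζ : ProbabilityMeasure ℝ}
    (hζ : MapClusterPt ζ atTop (zetaProb hR hΥ)) {T : ℝ} (hT : T ≠ 0)
    (hTζ : T ∈ (ζ : Measure ℝ).support) (herg : IsErgodic Γ ν) :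
    ENNReal.ofReal (Real.exp T) ∈ ratioSet Γ ν := by
  have hmeas := fun g => (hν g).measurable
  refine ofReal_exp_mem_ratioSet hR.measurable hR.map_one hmeas
    (exp_eq_rnDerivAction hν hR) hT fun A hA hpos δ hδ => ?_
  have hμ : IsMeasurePreserving Γ (Measure.dirac ()) := fun g => MeasurePreserving.id _
  obtain ⟨g, hg⟩ := exists_return_near hν hR hΥ hζ hTζ hμ
    (A := A ×ˢ Set.univ) (hA.prod MeasurableSet.univ)
    (by
      filter_upwards [Measure.quasiMeasurePreserving_fst.ae
        (herg.ae_exists_smul_mem hmeas hA hpos)] with p ⟨g, hg⟩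
      exact ⟨g, hg, trivial⟩) hδ
  refine ⟨g, hg.trans_le ?_⟩
  have e : {p : B × Unit | p ∈ A ×ˢ (Set.univ : Set Unit) ∧ g • p ∈ A ×ˢ (Set.univ : Set Unit) ∧
      |R g p.1 - T| < δ} = {b | b ∈ A ∧ g • b ∈ A ∧ |R g b - T| < δ} ×ˢ Set.univ := by
    ext p
    simp only [Set.mem_ofPred_eq, Set.mem_prod, Set.mem_univ, and_true, Prod.smul_fst]
  rw [e, Measure.prod_prod, measure_univ, mul_one]

omit [MetricSpace B] [CompactSpace B] [BorelSpace B] [Countable Γ] [MulAction Γ B] in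
theorem lintegral_prod_condExpKernel {X : Type*} [MeasurableSpace X] [StandardBorelSpace X]
    [MulAction Γ X] {μ : Measure X} [IsProbabilityMeasure μ] {E : Set (B × X)}
    (hE : MeasurableSet E) :
    ∫⁻ ω, (ν.prod (condExpKernel μ (invariantSets Γ X) ω)) E ∂μ = (ν.prod μ) E := by
  simp_rw [Measure.prod_apply_symm hE]
  exact lintegral_lintegral_condExpKernel (measurable_measure_prodMk_right hE)

theorem ofReal_exp_mem_stableRatioSet_of_isWeaklyMixing (hν : IsNonsingular Γ ν)
    (hR : IsLogRNCocycle ν R) (hΥ : IsAdmissibleFamily ν R Υ) {ζ : ProbabilityMeasure ℝ}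
    (hζ : MapClusterPt ζ atTop (zetaProb hR hΥ)) {T : ℝ} (hT : T ≠ 0)
    (hTζ : T ∈ (ζ : Measure ℝ).support) (hmix : IsWeaklyMixing Γ ν) :
    ENNReal.ofReal (Real.exp T) ∈ stableRatioSet Γ ν := by
  intro X _ _ _ μ _ hμ
  have hmeas := fun g => (hν.prod hμ.isNonsingular g).measurable
  have hr : ∀ g, Measurable fun p : B × X => R g p.1 := fun g =>
    (hR.measurable g).comp measurable_fst
  refine ofReal_exp_mem_ratioSet (r := fun g p => R g p.1) hr (fun p => hR.map_one p.1) hmeas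
    (fun g => ?_) hT fun A hA hpos δ hδ => ?_
  · filter_upwards [rnDerivAction_prod hν hμ g,
      Measure.quasiMeasurePreserving_fst.ae (exp_eq_rnDerivAction hν hR g)] with p h1 h2
    rw [h1, h2]
  by_contra! hcon
  have hle := invariantSets_le (Γ := Γ) (X := X)
  have hker : ∀ {E : Set (B × X)}, MeasurableSet E →
      Measurable fun ω => (ν.prod (condExpKernel μ (invariantSets Γ X) ω)) E := fun {E} hE => by
    simp_rw [Measure.prod_apply_symm hE]
    exact (measurable_measure_prodMk_right hE).lintegral_kernel.mono hle le_rfl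
  have hDm : ∀ g : Γ, MeasurableSet {p : B × X | p ∈ A ∧ g • p ∈ A ∧ |R g p.1 - T| < δ} := by
    intro g
    have := hR.measurable g
    exact hA.inter ((hmeas g hA).inter
      (measurableSet_lt (by fun_prop : Measurable fun p : B × X => |R g p.1 - T|)
        measurable_const))
  have hnull : ∀ᵐ ω ∂μ, ∀ g : Γ, (ν.prod (condExpKernel μ (invariantSets Γ X) ω))
      {p : B × X | p ∈ A ∧ g • p ∈ A ∧ |R g p.1 - T| < δ} = 0 := by
    refine ae_all_iff.2 fun g => ?_
    have h1 := lintegral_prod_condExpKernel (Γ := Γ) (ν := ν) (μ := μ) (hDm g)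
    rw [le_zero_iff.1 (hcon g), lintegral_eq_zero_iff (hker (hDm g))] at h1
    exact h1
  -- For an ergodic conditional measure, weak mixing would make the saturation of a non-null `A`
  -- conull and so produce a return near `T`. Hence `A` is null for almost every conditional
  -- measure, and integrating shows that it is null for `ν.prod μ`.
  have hno : ∀ᵐ ω ∂μ, (ν.prod (condExpKernel μ (invariantSets Γ X) ω)) A = 0 := by
    filter_upwards [hnull, ae_isErgodic_condExpKernel hμ,
      ae_isMeasurePreserving_condExpKernel hμ] with ω h1 h2 h3
    by_contra h4
    obtain ⟨g, hg⟩ := exists_return_near hν hR hΥ hζ hTζ h3 hA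
      ((hmix X _ h3 h2).ae_exists_smul_mem hmeas hA (pos_iff_ne_zero.2 h4)) hδ
    exact hg.ne' (h1 g)
  have h5 := lintegral_prod_condExpKernel (Γ := Γ) (ν := ν) (μ := μ) hA
  rw [lintegral_congr_ae hno, lintegral_zero] at h5
  exact hpos.ne h5

end RatioSet

end NonsingularAction

end

theorem corollary3p3 {Γ : Type*} [Group Γ] [Countable Γ]
    {B : Type*} [MetricSpace B] [CompactSpace B] [MeasurableSpace B] [BorelSpace B]
    [MulAction Γ B] (ν : Measure B) [IsProbabilityMeasure ν]
    (hν : NonsingularAction.IsNonsingular Γ ν)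
    (R : Γ → B → ℝ) (hR : NonsingularAction.IsLogRNCocycle ν R)
    (Υ : ℕ → Γ → B → B → ℝ≥0) (hΥ : NonsingularAction.IsAdmissibleFamily ν R Υ)
    (ζ : ProbabilityMeasure ℝ)
    (hζ : MapClusterPt ζ atTop (NonsingularAction.zetaProb hR hΥ))
    (T : ℝ) (hT : T ≠ 0) (hTζ : T ∈ (ζ : Measure ℝ).support) :
    (NonsingularAction.IsErgodic Γ ν → ¬ NonsingularAction.IsTypeIIIZero Γ ν) ∧
    (NonsingularAction.IsWeaklyMixing Γ ν → ¬ NonsingularAction.IsStableTypeIIIZero Γ ν) := by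
  refine ⟨fun herg h => NonsingularAction.ofReal_exp_notMem hT (h.2 ▸ ?_),
    fun hmix h => NonsingularAction.ofReal_exp_notMem hT (h.2 ▸ ?_)⟩
  · exact NonsingularAction.ofReal_exp_mem_ratioSet_of_isErgodic hν hR hΥ hζ hT hTζ herg
  · exact NonsingularAction.ofReal_exp_mem_stableRatioSet_of_isWeaklyMixing hν hR hΥ hζ hT hTζ hmix
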